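/- Let $d\ge 1$ and write points of $\mathbb{R}^{d+1}=\mathbb{R}\times\mathbb{R}^d$ as $\mathbf{x}=(t,x)$, $\mathbf{y}=(s,y)$, $\mathbf{z}=(r,z)$. Let $d(\mathbf{x},\mathbf{y})=\sqrt{|t-s|}+|x-y|$, let $B_R(\mathbf{x})$ be the open balls of this metric, and put $d_{\mathbf{x}}:=1-d(\mathbf{x},0)$. Let $\|\cdot\|_S$ denote the supremum norm over a set $S$. Let $\Lambda\in(0,1)$, $\eta\in(1,2)$, and let $\mathsf{A}\subset(0,\eta]$ be finite. Let $\rho:\mathbb{R}^{d+1}\to\mathbb{R}$ be a smooth function with compact support contained in $B_1(0)$, with $\rho(t,x)=\rho(t,-x)$ and $\int\rho\neq 0$. Put $\rho_\lambda(t,x)=\lambda^{-(d+2)}\rho(\lambda^{-2}t,\lambda^{-1}x)$ and $F_\lambda(\mathbf{x})=\int F(\mathbf{y})\rho_\lambda(\mathbf{x}-\mathbf{y})\,d\mathbf{y}$; for a family $U(\mathbf{x},\cdot)$ the mollification $U_\lambda(\mathbf{x},\cdot)$ acts on the second argument. For $U$ and $\gamma$ define, with values in $[0,\infty]$ (quotients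 being taken for $\mathbf{y}\ne\mathbf{x}$), $$\|U\|:=\sup\{|U(\mathbf{x},\mathbf{y})| : \mathbf{x}\in B_1(0),\ \mathbf{y}\in B_{d_{\mathbf{x}}}(\mathbf{x})\},$$ $$[U]_\eta:=\sup\Big\{d_{\mathbf{x}}^\eta\frac{|U(\mathbf{x},\mathbf{y})|}{d^\eta(\mathbf{y},\mathbf{x})} : \mathbf{x}\in B_1(0),\ \mathbf{y}\in B_{d_{\mathbf{x}}}(\mathbf{x})\Big\},$$ $$[\gamma]'_{\eta}:=\sup\Big\{d_{\mathbf{x}}^\eta\frac{|\gamma(\mathbf{x},\mathbf{y})|}{d^{\eta-1}(\mathbf{y},\mathbf{x})} : \mathbf{x}\in B_1(0),\ \mathbf{y}\in B_{\frac12 d_{\mathbf{x}}}(\mathbf{x})\Big\}.$$ Then there is a constant $C$, depending only on $\Lambda$, $\eta$, $\mathsf{A}$, $d$ and $\rho$, such that the following holds. Let $\{U(\mathbf{x},\cdot)\}_{\mathbf{x}\in B_1(0)}$ be a family of real-valued smooth functions on $B_1(0)$ with $U(\mathbf{x},\mathbf{x})=0$ and $\nabla_y|_{\mathbf{y}=\mathbf{x}}U(\mathbf{x},\mathbf{y})=0$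 for all $\mathbf{x}\in B_1(0)$ and with $[U]_\eta<\infty$. Let $\gamma:B_1(0)\times B_1(0)\to\mathbb{R}^d$ and $M>0$ satisfy: 1. (Local splitting) for all $\mathbf{x}\in B_1(0)$, $\lambda\in(0,\frac1{10}d_{\mathbf{x}})$ and $R\in(0,\frac12 d_{\mathbf{x}})$ with $\lambda\le\frac12R$, $$d_{\mathbf{x}}^\eta\inf_{a_0,\ell_0}\|(\partial_s-a_0\Delta)U_\lambda(\mathbf{x},\cdot)-\ell_0\|_{B_R(\mathbf{x})}\le M\sum_{\kappa\in\mathsf{A}}R^{\eta-\kappa}\lambda^{\kappa-2},$$ where the infimum runs over $a_0\in[\Lambda,\Lambda^{-1}]$ and functions $\ell_0(\mathbf{y})=c_0+\nu_0\cdot(y-x)$ with $c_0\in\mathbb{R}$, $\nu_0\in\mathbb{R}^d$; 2. (Three-point continuity) for all $\mathbf{x}\in B_1(0)$, $\mathbf{y}\in B_{\frac12d_{\mathbf{x}}}(\mathbf{x})$ and $\mathbf{z}\in B_{\frac12d_{\mathbf{x}}}(\mathbf{y})$, $$d_{\mathbf{x}}^\eta\,\big|U(\mathbf{x},\mathbf{z})-U(\mathbf{x},\mathbf{y})-U(\mathbf{y},\mathbf{z})-\gamma(\mathbf{x},\mathbf{y})\cdot(z-y)\big|\le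 M\sum_{\kappa\in\mathsf{A}}d^\kappa(\mathbf{y},\mathbf{x})\,d^{\eta-\kappa}(\mathbf{z},\mathbf{y}).$$ Then $$[U]_\eta+[\gamma]'_{\eta}\le C\,(M+\|U\|).$$ -/

import Mathlib

open MeasureTheory
open scoped ENNReal NNReal ContDiff Laplacian

/-- Space-time `ℝ × ℝᵈ`; points are `(t, x)` with `x` in Euclidean space. -/
abbrev SpaceTime (d : ℕ) : Type := ℝ × EuclideanSpace ℝ (Fin d)

noncomputable section

namespace Jets

variable {d : ℕ}

/-- The parabolic (Carnot-Carathéodory) distance `√|t - s| + |x - y|`. -/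
def pdist (x y : SpaceTime d) : ℝ := Real.sqrt |x.1 - y.1| + ‖x.2 - y.2‖

/-- The open parabolic ball `B_r(x)`. -/
def pball (x : SpaceTime d) (r : ℝ) : Set (SpaceTime d) := {y | pdist y x < r}

/-- The distance `1 - d(x, 0)` of `x` from the boundary of the unit ball. -/
def bdist (x : SpaceTime d) : ℝ := 1 - pdist x 0

/-- The parabolic rescaling `ρ_lam(t, x) = lam^{-(d+2)} ρ(lam^{-2} t, lam^{-1} x)`. -/
def rescale (ρ : SpaceTime d → ℝ) (lam : ℝ) (x : SpaceTime d) : ℝ :=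
  (lam ^ (d + 2))⁻¹ * ρ ((lam ^ 2)⁻¹ * x.1, lam⁻¹ • x.2)

/-- The mollification `F_lam(x) = ∫ F(y) ρ_lam(x - y) dy`. -/
def mollify (ρ : SpaceTime d → ℝ) (lam : ℝ) (F : SpaceTime d → ℝ) (x : SpaceTime d) : ℝ :=
  ∫ y, F y * rescale ρ lam (x - y)

/-- The parabolic operator `(∂_s - a₀ Δ) F` at the point `y = (s, y)`. -/
def heatOp (a₀ : ℝ) (F : SpaceTime d → ℝ) (y : SpaceTime d) : ℝ :=
  deriv (fun s : ℝ => F (s, y.2)) y.1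
    - a₀ * (Δ fun v : EuclideanSpace ℝ (Fin d) => F (y.1, v)) y.2

/-- The spatial gradient of `F` at the point `y`. -/
def spaceGrad (F : SpaceTime d → ℝ) (y : SpaceTime d) : EuclideanSpace ℝ (Fin d) :=
  gradient (fun v : EuclideanSpace ℝ (Fin d) => F (y.1, v)) y.2

/-- The supremum norm of `F` on the set `S`, with values in `[0, ∞]`. -/
def supNormOn (S : Set (SpaceTime d)) (F : SpaceTime d → ℝ) : ℝ≥0∞ :=
  ⨆ y ∈ S, ENNReal.ofReal |F y|

/-- A smooth kernel, compactly supported in the open parabolic unit ball, even in the space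
variable, and of non-zero total mass. -/
structure IsSymmKernel (ρ : SpaceTime d → ℝ) : Prop where
  smooth : ContDiff ℝ ∞ ρ
  hasCompactSupport : HasCompactSupport ρ
  tsupport_subset : tsupport ρ ⊆ pball 0 1
  symm : ∀ (t : ℝ) (x : EuclideanSpace ℝ (Fin d)), ρ (t, x) = ρ (t, -x)
  integral_ne_zero : (∫ x, ρ x) ≠ 0

/-- The sup-norm `‖U‖` of a jet. -/
def jetSup (U : SpaceTime d → SpaceTime d → ℝ) : ℝ≥0∞ :=
  ⨆ x ∈ pball (0 : SpaceTime d) 1, supNormOn (pball x (bdist x)) (U x)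

/-- The weighted Hölder norm `[U]_η` of a jet; the points of the supremum are those where the
quotient is meaningful, that is `y ≠ x`. -/
def jetHolder (η : ℝ) (U : SpaceTime d → SpaceTime d → ℝ) : ℝ≥0∞ :=
  ⨆ x ∈ pball (0 : SpaceTime d) 1, ⨆ y ∈ pball x (bdist x) \ {x},
    ENNReal.ofReal (bdist x ^ η * (|U x y| / pdist y x ^ η))

/-- The weighted norm of order `η - 1` of the Gubinelli-type derivative, taken over the
smaller balls `B_{bdist x / 2}(x)`. -/
def gubHolder (η : ℝ) (γ : SpaceTime d → SpaceTime d → EuclideanSpace ℝ (Fin d)) : ℝ≥0∞ :=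
  ⨆ x ∈ pball (0 : SpaceTime d) 1, ⨆ y ∈ pball x (bdist x / 2) \ {x},
    ENNReal.ofReal (bdist x ^ η * (‖γ x y‖ / pdist y x ^ (η - 1)))

/-- A jet of smooth functions on `B_1(0)` that vanish to first order at the base point. -/
structure IsCenteredJet (U : SpaceTime d → SpaceTime d → ℝ) : Prop where
  smooth : ∀ x ∈ pball (0 : SpaceTime d) 1, ContDiffOn ℝ ∞ (U x) (pball 0 1)
  apply_self : ∀ x ∈ pball (0 : SpaceTime d) 1, U x x = 0
  grad_self : ∀ x ∈ pball (0 : SpaceTime d) 1, spaceGrad (U x) x = 0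

/-- Local splitting: the infimum runs over `a₀ ∈ [Λ, Λ⁻¹]` and over the (spatially) affine
functions `ℓ₀(y) = c₀ + ν₀ · (y - x)`. -/
def LocalSplitting (Λ η : ℝ) (A : Finset ℝ) (ρ : SpaceTime d → ℝ)
    (U : SpaceTime d → SpaceTime d → ℝ) (M : ℝ) : Prop :=
  ∀ x ∈ pball (0 : SpaceTime d) 1, ∀ lam R : ℝ,
    0 < lam → lam < bdist x / 10 → 0 < R → R < bdist x / 2 → lam ≤ R / 2 →
    ENNReal.ofReal (bdist x ^ η) *
      (⨅ a₀ ∈ Set.Icc Λ Λ⁻¹, ⨅ (c₀ : ℝ) (ν₀ : EuclideanSpace ℝ (Fin d)),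
        supNormOn (pball x R) fun y =>
          heatOp a₀ (mollify ρ lam (U x)) y - (c₀ + inner ℝ ν₀ (y.2 - x.2)))
      ≤ ENNReal.ofReal (M * ∑ κ ∈ A, R ^ (η - κ) * lam ^ (κ - 2))

/-- Three-point continuity of the jet `U` with derivative `γ`. -/
def ThreePointContinuity (η : ℝ) (A : Finset ℝ) (U : SpaceTime d → SpaceTime d → ℝ)
    (γ : SpaceTime d → SpaceTime d → EuclideanSpace ℝ (Fin d)) (M : ℝ) : Prop :=
  ∀ x ∈ pball (0 : SpaceTime d) 1, ∀ y ∈ pball x (bdist x / 2), ∀ z ∈ pball y (bdist x / 2),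
    bdist x ^ η * |U x z - U x y - U y z - inner ℝ (γ x y) (z.2 - y.2)|
      ≤ M * ∑ κ ∈ A, pdist y x ^ κ * pdist z y ^ (η - κ)

end Jets

end

/-!
The proof is an absorption argument: `T = [U]_η` is finite by assumption, and it is shown that
`T ≤ θ T + C (M + ‖U‖)` with `θ < 1`. Write `D = bdist x` and `c = ∫ ρ`.

*Interior regularity.* Three-point continuity is applied at a point `y ∈ B_R(x)` and integrated
against `ρ_lam (y - ·)`. The term with `γ` drops out because `ρ` is even in space, and so
`U_lam(x, ·)` differs from `c U(x, ·)` on `B_R(x)` by a multiple of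
`D^{-η} (T lam^η + M R^η)` (`abs_mollify_cutJet_sub_le`). A second mollification at the same scale
costs no more, and makes all derivatives of the right-hand side of the splitting equation available.
For the twofold mollification `v` neither a fundamental solution nor a solvability result is needed:
`v` and `∂_e v` satisfy heat equations with controlled right-hand sides, so that Bernstein's
maximum-principle argument for `ζ² (∂_e v)² + k R⁻² v²` (`bernstein`), applied twice, bounds the
second spatial derivatives and, through the equation, the time derivative of `v` on `B_{R/32}(x)` by
`sup |U_lam(x, ·)| / R²` plus a multiple of `M` (`interior_estimate`). The affine part of the
right-hand side is controlled by testing the equation with `ρ` at scale `R / 4` (`abs_aff_le`).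

*Decay.* With `lam = δ² R`, time increments `U(x, (s, y)) - U(x, (t, y))` and second spatial
increments `U(x, (t, x + 2h)) - 2 U(x, (t, x + h))` in `B_{δR}(x)` are therefore at most
`C D^{-η} R^η (δ² T + δ^{-8} M)` (`increment_bound`); relative to `(δ R)^η` this is small compared
with `T`, as `η < 2`.

*Absorption.* The second increment compares `U(x, (t, x + 2h))` with `2 U(x, (t, x + h))`, whose
size is at most `2^{1-η} T D^{-η} |2h|^η`. Since `η > 1`, the factor `2^{1-η}` is less than one and
`T` is absorbed for small `δ`; points far from `x` are covered by the sup-norm (`jetHolder_le`).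
The bound on `γ` is then immediate from three-point continuity (`gubHolder_le`).
-/

namespace Jets

variable {d : ℕ}

/-! ### The parabolic distance -/

lemma pdist_nonneg (x y : SpaceTime d) : 0 ≤ pdist x y := by unfold pdist; positivity

lemma pdist_self (x : SpaceTime d) : pdist x x = 0 := by simp [pdist]

lemma pdist_comm (x y : SpaceTime d) : pdist x y = pdist y x := by
  simp only [pdist, abs_sub_comm x.1, norm_sub_rev x.2]

lemma sqrt_abs_add_le (a b : ℝ) : √|a + b| ≤ √|a| + √|b| := by
  refine Real.sqrt_le_iff.2 ⟨by positivity, ?_⟩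
  have h1 := Real.sq_sqrt (abs_nonneg a)
  have h2 := Real.sq_sqrt (abs_nonneg b)
  nlinarith [abs_add_le a b, Real.sqrt_nonneg |a|, Real.sqrt_nonneg |b|,
    mul_nonneg (Real.sqrt_nonneg |a|) (Real.sqrt_nonneg |b|)]

lemma pdist_triangle (x y z : SpaceTime d) : pdist x z ≤ pdist x y + pdist y z := by
  have h1 := sqrt_abs_add_le (x.1 - y.1) (y.1 - z.1)
  have h2 := norm_add_le (x.2 - y.2) (y.2 - z.2)
  simp only [sub_add_sub_cancel] at h1 h2
  simp only [pdist]
  linarith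

lemma continuous_pdist (x : SpaceTime d) : Continuous fun y : SpaceTime d => pdist y x := by
  unfold pdist; fun_prop

lemma isOpen_pball (x : SpaceTime d) (r : ℝ) : IsOpen (pball x r) :=
  isOpen_lt (continuous_pdist x) continuous_const

lemma mem_pball {x y : SpaceTime d} {r : ℝ} : y ∈ pball x r ↔ pdist y x < r := Iff.rfl

lemma pball_subset_pball {x y : SpaceTime d} {r s : ℝ} (h : pdist y x + r ≤ s) :
    pball y r ⊆ pball x s := fun z hz => by
  have := pdist_triangle z y x
  rw [mem_pball] at *
  linarith

lemma norm_snd_sub_le_pdist (x y : SpaceTime d) : ‖x.2 - y.2‖ ≤ pdist x y :=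
  le_add_of_nonneg_left (Real.sqrt_nonneg _)

lemma abs_fst_sub_le_pdist_sq (x y : SpaceTime d) : |x.1 - y.1| ≤ pdist x y ^ 2 := by
  have h : √|x.1 - y.1| ≤ pdist x y := le_add_of_nonneg_right (norm_nonneg _)
  calc |x.1 - y.1| = √|x.1 - y.1| ^ 2 := (Real.sq_sqrt (abs_nonneg _)).symm
    _ ≤ _ := by gcongr

lemma eq_of_pdist_eq_zero {x y : SpaceTime d} (h : pdist x y = 0) : x = y := by
  have h1 := norm_snd_sub_le_pdist x y
  have h2 := abs_fst_sub_le_pdist_sq x y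
  rw [h] at h1 h2
  refine Prod.ext ?_ ?_
  · have := abs_nonneg (x.1 - y.1)
    exact sub_eq_zero.1 (abs_eq_zero.1 (by linarith))
  · exact sub_eq_zero.1 (norm_le_zero_iff.1 h1)

lemma isCompact_closed_pball (x : SpaceTime d) (r : ℝ) :
    IsCompact {y : SpaceTime d | pdist y x ≤ r} := by
  refine Metric.isCompact_of_isClosed_isBounded
    (isClosed_le (continuous_pdist x) continuous_const) ?_
  refine (Metric.isBounded_closedBall (x := x) (r := max (r ^ 2) r)).subset fun y hy => ?_
  have h0 := pdist_nonneg y x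
  have h1 := norm_snd_sub_le_pdist y x
  have h2 := abs_fst_sub_le_pdist_sq y x
  simp only [Set.mem_ofPred_eq] at hy
  rw [Metric.mem_closedBall, dist_eq_norm, Prod.norm_def]
  refine max_le_max ?_ (h1.trans hy)
  exact h2.trans (by gcongr)

lemma bdist_le_of_mem {x y : SpaceTime d} {r : ℝ} (hy : y ∈ pball x r) :
    bdist x - r < bdist y := by
  have := pdist_triangle y x 0
  rw [mem_pball] at hy
  unfold bdist; linarith

lemma bdist_pos {x : SpaceTime d} (hx : x ∈ pball (0 : SpaceTime d) 1) : 0 < bdist x := by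
  rw [mem_pball] at hx; unfold bdist; linarith

lemma pball_bdist_subset (x : SpaceTime d) : pball x (bdist x) ⊆ pball 0 1 :=
  pball_subset_pball (by unfold bdist; linarith)

/-! ### Directional derivatives and the heat operator -/

/-- The derivative of `F` in the space-time direction `w`. -/
noncomputable def dirD (w : SpaceTime d) (F : SpaceTime d → ℝ) (z : SpaceTime d) : ℝ :=
  fderiv ℝ F z w

/-- The spatial direction `e`, as a direction in space-time. -/
def spc (e : EuclideanSpace ℝ (Fin d)) : SpaceTime d := (0, e)

/-- The time direction. -/
def tdir : SpaceTime d := (1, 0)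

/-- The `i`-th coordinate direction of space, as a direction in space-time. -/
noncomputable def bas (i : Fin d) : SpaceTime d := spc (EuclideanSpace.basisFun (Fin d) ℝ i)

/-- The operator `∂_t - a Δ`, written with iterated directional derivatives in space-time. It
agrees with `heatOp a` on smooth functions. -/
noncomputable def heatD (a : ℝ) (F : SpaceTime d → ℝ) (z : SpaceTime d) : ℝ :=
  dirD tdir F z - a * ∑ i, dirD (bas i) (dirD (bas i) F) z

lemma contDiff_dirD {F : SpaceTime d → ℝ} (hF : ContDiff ℝ ∞ F) (w : SpaceTime d) :
    ContDiff ℝ ∞ (dirD w F) :=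
  (hF.fderiv_right (m := ∞) (by simp)).clm_apply contDiff_const

lemma contDiff_heatD {F : SpaceTime d → ℝ} (hF : ContDiff ℝ ∞ F) (a : ℝ) :
    ContDiff ℝ ∞ (heatD a F) :=
  (contDiff_dirD hF _).sub
    (contDiff_const.mul (ContDiff.sum fun _ _ => contDiff_dirD (contDiff_dirD hF _) _))

lemma differentiable_of_smooth {F : SpaceTime d → ℝ} (hF : ContDiff ℝ ∞ F) :
    Differentiable ℝ F := hF.differentiable (by simp)

lemma dirD_add {F G : SpaceTime d → ℝ} (hF : ContDiff ℝ ∞ F) (hG : ContDiff ℝ ∞ G)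
    (w : SpaceTime d) : dirD w (F + G) = dirD w F + dirD w G := by
  ext z
  simp [dirD, fderiv_add (differentiable_of_smooth hF z) (differentiable_of_smooth hG z)]

lemma dirD_mul {F G : SpaceTime d → ℝ} (hF : ContDiff ℝ ∞ F) (hG : ContDiff ℝ ∞ G)
    (w : SpaceTime d) : dirD w (F * G) = F * dirD w G + dirD w F * G := by
  ext z
  simp [dirD, fderiv_mul (differentiable_of_smooth hF z) (differentiable_of_smooth hG z), mul_comm]

lemma dirD_const_smul {F : SpaceTime d → ℝ} (hF : ContDiff ℝ ∞ F) (c : ℝ)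
    (w : SpaceTime d) : dirD w (c • F) = c • dirD w F := by
  ext z
  simp [dirD, fderiv_const_smul (differentiable_of_smooth hF z)]

lemma dirD_smul (c : ℝ) (w : SpaceTime d) (F : SpaceTime d → ℝ) :
    dirD (c • w) F = c • dirD w F := by
  ext z; simp [dirD]

lemma spc_smul (c : ℝ) (e : EuclideanSpace ℝ (Fin d)) : spc (c • e) = c • spc e := by
  simp [spc]

/-- Along the line through `z` in direction `w`, the ordinary derivative is `dirD w`. -/
lemma hasDerivAt_line {F : SpaceTime d → ℝ} (hF : ContDiff ℝ ∞ F) (z w : SpaceTime d) (τ : ℝ) :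
    HasDerivAt (fun τ : ℝ => F (z + τ • w)) (dirD w F (z + τ • w)) τ := by
  have h1 : HasDerivAt (fun τ : ℝ => z + τ • w) w τ := by
    simpa using ((hasDerivAt_id τ).smul_const w).const_add z
  exact (differentiable_of_smooth hF _).hasFDerivAt.comp_hasDerivAt τ h1

lemma dirD_dirD {F : SpaceTime d → ℝ} (hF : ContDiff ℝ ∞ F) (v w z : SpaceTime d) :
    dirD v (dirD w F) z = fderiv ℝ (fderiv ℝ F) z v w := by
  have h : Differentiable ℝ (fderiv ℝ F) :=
    (hF.fderiv_right (m := ∞) (by simp)).differentiable (by simp)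
  change fderiv ℝ (fun z => fderiv ℝ F z w) z v = _
  rw [fderiv_clm_apply (h z) (differentiableAt_const w)]
  simp

lemma sum_sq_dirD_bas_ge {F : SpaceTime d → ℝ} {e : EuclideanSpace ℝ (Fin d)} (he : ‖e‖ = 1)
    (z : SpaceTime d) : dirD (spc e) F z ^ 2 ≤ ∑ i, dirD (bas i) F z ^ 2 := by
  have h : dirD (spc e) F z = ∑ i, e i * dirD (bas i) F z := by
    have h1 : spc e = ∑ i, e i • bas (d := d) i := by
      have := (EuclideanSpace.basisFun (Fin d) ℝ).sum_repr e
      have h2 : ∑ i, e i • bas (d := d) i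
          = spc (∑ i, e i • EuclideanSpace.basisFun (Fin d) ℝ i) := by
        simp [bas, spc, Prod.ext_iff, Prod.fst_sum, Prod.snd_sum]
      rw [h2]
      congr 1
      simpa using this.symm
    simp only [dirD]
    rw [h1, map_sum]
    simp
  rw [h]
  refine (Finset.sum_mul_sq_le_sq_mul_sq _ _ _).trans ?_
  have h2 : ∑ i, e i ^ 2 = 1 := by
    rw [← EuclideanSpace.real_norm_sq_eq, he, one_pow]
  rw [h2, one_mul]

lemma heatOp_eq_heatD {F : SpaceTime d → ℝ} (hF : ContDiff ℝ ∞ F) (a : ℝ) (z : SpaceTime d) :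
    heatOp a F z = heatD a F z := by
  unfold heatOp heatD
  congr 1
  · have := hasDerivAt_line hF (0, z.2) tdir z.1
    simpa [tdir] using this.deriv
  · congr 1
    have hF' : ContDiff ℝ ∞ fun v : EuclideanSpace ℝ (Fin d) => F (z.1, v) :=
      hF.comp (contDiff_const.prodMk contDiff_id)
    rw [InnerProductSpace.laplacian_eq_iteratedFDeriv_orthonormalBasis _
      (EuclideanSpace.basisFun (Fin d) ℝ)]
    refine Finset.sum_congr rfl fun i _ => ?_
    have key : ∀ (G : SpaceTime d → ℝ), ContDiff ℝ ∞ G → ∀ u e : EuclideanSpace ℝ (Fin d),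
        fderiv ℝ (fun v : EuclideanSpace ℝ (Fin d) => G (z.1, v)) u e
          = dirD (spc e) G (z.1, u) := by
      intro G hG u e
      have h1 : HasFDerivAt (fun v : EuclideanSpace ℝ (Fin d) => ((z.1, v) : SpaceTime d))
          (ContinuousLinearMap.inr ℝ ℝ (EuclideanSpace ℝ (Fin d))) u := hasFDerivAt_prodMk_right _ _
      have h2 := (differentiable_of_smooth hG (z.1, u)).hasFDerivAt.comp u h1
      have h3 := h2.fderiv
      simp only [Function.comp_def] at h3
      rw [h3]
      simp [dirD, spc]
    have h2 : Differentiable ℝ (fderiv ℝ fun v : EuclideanSpace ℝ (Fin d) => F (z.1, v)) :=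
      (hF'.fderiv_right (m := ∞) (by simp)).differentiable (by simp)
    rw [iteratedFDeriv_two_apply]
    simp only [Matrix.cons_val_zero, Matrix.cons_val_one]
    set e := EuclideanSpace.basisFun (Fin d) ℝ i
    have h4 : fderiv ℝ (fderiv ℝ fun v : EuclideanSpace ℝ (Fin d) => F (z.1, v)) z.2 e e
        = fderiv ℝ (fun u => fderiv ℝ (fun v : EuclideanSpace ℝ (Fin d) => F (z.1, v)) u e)
          z.2 e := by
      rw [fderiv_clm_apply (h2 _) (differentiableAt_const e)]
      simp
    rw [h4, funext fun u => key F hF u e, key _ (contDiff_dirD hF _)]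
    rfl

lemma heatOp_congr {F G : SpaceTime d → ℝ} {S : Set (SpaceTime d)} (hS : IsOpen S)
    (h : ∀ z ∈ S, F z = G z) (a : ℝ) {z : SpaceTime d} (hz : z ∈ S) :
    heatOp a F z = heatOp a G z := by
  have hS' : ∀ᶠ y in nhds z, F y = G y :=
    Filter.eventually_of_mem (hS.mem_nhds hz) h
  unfold heatOp
  congr 1
  · refine Filter.EventuallyEq.deriv_eq ?_
    have hc : Filter.Tendsto (fun s : ℝ => ((s, z.2) : SpaceTime d)) (nhds z.1) (nhds z) :=
      Continuous.tendsto (f := fun s : ℝ => ((s, z.2) : SpaceTime d)) (by fun_prop) z.1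
    exact hc.eventually hS'
  · congr 1
    refine (InnerProductSpace.laplacian_congr_nhds ?_).eq_of_nhds
    have hc : Filter.Tendsto (fun v => ((z.1, v) : SpaceTime d)) (nhds z.2) (nhds z) :=
      Continuous.tendsto (f := fun v => ((z.1, v) : SpaceTime d)) (by fun_prop) z.2
    exact hc.eventually hS'

/-! ### Bernstein's gradient estimate -/

lemma dirD_eq_zero_of_isLocalMax {W : SpaceTime d → ℝ} {z : SpaceTime d} (h : IsLocalMax W z)
    (w : SpaceTime d) : dirD w W z = 0 := by
  simp [dirD, h.fderiv_eq_zero]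

lemma dirD_dirD_nonpos_of_isLocalMax {W : SpaceTime d → ℝ} (hW : ContDiff ℝ ∞ W)
    {z : SpaceTime d} (h : IsLocalMax W z) (w : SpaceTime d) : dirD w (dirD w W) z ≤ 0 := by
  by_contra! hpos
  set g : ℝ → ℝ := fun τ => W (z + τ • w) with hg
  have hg1 : deriv g = fun τ => dirD w W (z + τ • w) :=
    funext fun τ => (hasDerivAt_line hW z w τ).deriv
  have hg2 : deriv (deriv g) 0 = dirD w (dirD w W) z := by
    rw [hg1]
    simpa using (hasDerivAt_line (contDiff_dirD hW w) z w 0).deriv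
  have hg0 : deriv g 0 = 0 := by
    rw [hg1]
    simpa using dirD_eq_zero_of_isLocalMax h w
  have hmin : IsLocalMin g 0 :=
    isLocalMin_of_deriv_deriv_pos (by rw [hg2]; exact hpos) hg0
      (hasDerivAt_line hW z w 0).continuousAt
  have hmax : IsLocalMax g 0 := by
    have hc : Filter.Tendsto (fun τ : ℝ => z + τ • w) (nhds 0) (nhds z) := by
      have : Continuous fun τ : ℝ => z + τ • w := by fun_prop
      simpa using this.tendsto 0
    have := hc.eventually h
    simpa [IsLocalMax, IsMaxFilter, hg] using this
  have hconst : g =ᶠ[nhds 0] fun _ => g 0 := by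
    filter_upwards [hmin, hmax] with τ h1 h2
    exact le_antisymm h2 h1
  have : deriv (deriv g) 0 = 0 := by
    rw [hconst.deriv.deriv_eq]
    simp
  linarith

lemma heatD_nonneg_of_isLocalMax {W : SpaceTime d → ℝ} (hW : ContDiff ℝ ∞ W)
    {z : SpaceTime d} (h : IsLocalMax W z) {a : ℝ} (ha : 0 ≤ a) : 0 ≤ heatD a W z := by
  unfold heatD
  rw [dirD_eq_zero_of_isLocalMax h, zero_sub, ← mul_neg, ← Finset.sum_neg_distrib]
  exact mul_nonneg ha
    (Finset.sum_nonneg fun i _ => neg_nonneg.2 (dirD_dirD_nonpos_of_isLocalMax hW h _))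

lemma heatD_add {F G : SpaceTime d → ℝ} (hF : ContDiff ℝ ∞ F) (hG : ContDiff ℝ ∞ G) (a : ℝ)
    (z : SpaceTime d) : heatD a (F + G) z = heatD a F z + heatD a G z := by
  simp only [heatD, dirD_add hF hG, dirD_add (contDiff_dirD hF _) (contDiff_dirD hG _),
    Pi.add_apply, Finset.sum_add_distrib]
  ring

lemma heatD_const_smul {F : SpaceTime d → ℝ} (hF : ContDiff ℝ ∞ F) (c a : ℝ)
    (z : SpaceTime d) : heatD a (c • F) z = c * heatD a F z := by
  simp only [heatD, dirD_const_smul hF, dirD_const_smul (contDiff_dirD hF _),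
    Pi.smul_apply, smul_eq_mul, ← Finset.mul_sum]
  ring

lemma heatD_mul {F G : SpaceTime d → ℝ} (hF : ContDiff ℝ ∞ F) (hG : ContDiff ℝ ∞ G) (a : ℝ)
    (z : SpaceTime d) : heatD a (F * G) z = F z * heatD a G z + G z * heatD a F z
      - 2 * a * ∑ i, dirD (bas i) F z * dirD (bas i) G z := by
  have h1 : ∀ i : Fin d, dirD (bas i) (dirD (bas i) (F * G)) z
      = F z * dirD (bas i) (dirD (bas i) G) z + G z * dirD (bas i) (dirD (bas i) F) z
        + 2 * (dirD (bas i) F z * dirD (bas i) G z) := by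
    intro i
    have hFi := contDiff_dirD hF (bas i)
    have hGi := contDiff_dirD hG (bas i)
    have h1 : ContDiff ℝ ∞ (F * dirD (bas i) G) := hF.mul hGi
    have h2 : ContDiff ℝ ∞ (dirD (bas i) F * G) := hFi.mul hG
    rw [dirD_mul hF hG, dirD_add h1 h2, dirD_mul hF hGi, dirD_mul hFi hG]
    simp only [Pi.add_apply, Pi.mul_apply]
    ring
  simp only [heatD, h1, Finset.sum_add_distrib, ← Finset.mul_sum]
  rw [dirD_mul hF hG, Pi.add_apply, Pi.mul_apply, Pi.mul_apply]
  ring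

/-- A quadratic cut-off, equal to `1` at `x`, decreasing away from `x`, and vanishing on the
boundary of the solid `parEll x R`. Being a polynomial, it has explicit derivatives. -/
noncomputable def cut (x : SpaceTime d) (R : ℝ) (z : SpaceTime d) : ℝ :=
  1 - (R ^ 2)⁻¹ * ‖z.2 - x.2‖ ^ 2 - (R ^ 4)⁻¹ * (z.1 - x.1) ^ 2

/-- The solid `|z - x|² / R² + (r - t)² / R⁴ ≤ 1`, a neighbourhood of `x` of parabolic size `R`. -/
def parEll (x : SpaceTime d) (R : ℝ) : Set (SpaceTime d) := {z | 0 ≤ cut x R z}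

lemma contDiff_cut (x : SpaceTime d) (R : ℝ) : ContDiff ℝ ∞ (cut x R) := by
  have h1 : ContDiff ℝ ∞ fun z : SpaceTime d => ‖z.2 - x.2‖ ^ 2 :=
    (contDiff_snd.sub contDiff_const).norm_sq ℝ
  have h2 : ContDiff ℝ ∞ fun z : SpaceTime d => (z.1 - x.1) ^ 2 :=
    (contDiff_fst.sub contDiff_const).pow 2
  exact (contDiff_const.sub (contDiff_const.mul h1)).sub (contDiff_const.mul h2)

lemma dirD_tdir_cut (x : SpaceTime d) (R : ℝ) (z : SpaceTime d) :
    dirD tdir (cut x R) z = -(R ^ 4)⁻¹ * (2 * (z.1 - x.1)) := by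
  have h := hasDerivAt_line (contDiff_cut x R) z tdir 0
  have h2 : HasDerivAt (fun τ : ℝ => cut x R (z + τ • tdir))
      (-(R ^ 4)⁻¹ * (2 * (z.1 - x.1))) 0 := by
    have h3 : (fun τ : ℝ => cut x R (z + τ • tdir)) = fun τ : ℝ =>
        1 - (R ^ 2)⁻¹ * ‖z.2 - x.2‖ ^ 2 - (R ^ 4)⁻¹ * (z.1 - x.1 + τ) ^ 2 := by
      funext τ
      simp only [cut, tdir, Prod.fst_add, Prod.snd_add, Prod.smul_fst, Prod.smul_snd, smul_zero,
        add_zero, smul_eq_mul, mul_one]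
      ring
    rw [h3]
    have h4 := (((hasDerivAt_id (0 : ℝ)).const_add (z.1 - x.1)).pow 2).const_mul (R ^ 4)⁻¹
    simpa using h4.const_sub (1 - (R ^ 2)⁻¹ * ‖z.2 - x.2‖ ^ 2)
  have := h.unique h2
  simpa using this

lemma dirD_bas_cut (x : SpaceTime d) (R : ℝ) (i : Fin d) :
    dirD (bas i) (cut x R) = fun z => -(R ^ 2)⁻¹ * (2 * (z.2 - x.2) i) := by
  funext z
  have h := hasDerivAt_line (contDiff_cut x R) z (bas i) 0
  have h2 : HasDerivAt (fun τ : ℝ => cut x R (z + τ • bas i))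
      (-(R ^ 2)⁻¹ * (2 * (z.2 - x.2) i)) 0 := by
    have h3 : (fun τ : ℝ => cut x R (z + τ • bas i)) = fun τ : ℝ =>
        1 - (R ^ 4)⁻¹ * (z.1 - x.1) ^ 2
          - (R ^ 2)⁻¹ * (‖z.2 - x.2‖ ^ 2 + 2 * τ * (z.2 - x.2) i + τ ^ 2) := by
      funext τ
      have e : (z + τ • bas i).2 - x.2
          = (z.2 - x.2) + τ • EuclideanSpace.basisFun (Fin d) ℝ i := by
        simp [bas, spc]; abel
      simp only [cut]
      rw [e, norm_add_sq_real, inner_smul_right, norm_smul, mul_pow]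
      have e2 : inner ℝ (z.2 - x.2) (EuclideanSpace.basisFun (Fin d) ℝ i) = (z.2 - x.2) i := by
        rw [real_inner_comm, EuclideanSpace.basisFun_inner]
      rw [e2]
      simp only [OrthonormalBasis.norm_eq_one, Real.norm_eq_abs, sq_abs]
      simp only [bas, spc, Prod.fst_add, Prod.smul_fst, smul_zero, add_zero]
      ring
    rw [h3]
    have h4 := ((((hasDerivAt_id (0 : ℝ)).const_mul 2).mul_const ((z.2 - x.2) i)).const_add
      (‖z.2 - x.2‖ ^ 2)).add ((hasDerivAt_id (0 : ℝ)).pow 2)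
    simpa using (h4.const_mul (R ^ 2)⁻¹).const_sub (1 - (R ^ 4)⁻¹ * (z.1 - x.1) ^ 2)
  have := h.unique h2
  simpa using this

lemma dirD_bas_bas_cut (x : SpaceTime d) (R : ℝ) (i : Fin d) (z : SpaceTime d) :
    dirD (bas i) (dirD (bas i) (cut x R)) z = -(R ^ 2)⁻¹ * 2 := by
  have h := hasDerivAt_line (contDiff_dirD (contDiff_cut x R) (bas i)) z (bas i) 0
  rw [dirD_bas_cut] at h
  have h2 : HasDerivAt (fun τ : ℝ => -(R ^ 2)⁻¹ * (2 * ((z + τ • bas i).2 - x.2) i))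
      (-(R ^ 2)⁻¹ * 2) 0 := by
    have h3 : (fun τ : ℝ => -(R ^ 2)⁻¹ * (2 * ((z + τ • bas i).2 - x.2) i)) = fun τ : ℝ =>
        -(R ^ 2)⁻¹ * (2 * ((z.2 - x.2) i + τ)) := by
      funext τ
      have : ((z + τ • bas i).2 - x.2) i = (z.2 - x.2) i + τ := by
        simp [bas, spc]; ring
      rw [this]
    rw [h3]
    simpa using (((hasDerivAt_id (0 : ℝ)).const_add ((z.2 - x.2) i)).const_mul 2).const_mul
      (-(R ^ 2)⁻¹)
  rw [dirD_bas_cut]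
  simpa using h.unique h2

lemma mem_parEll {x z : SpaceTime d} {R : ℝ} (hz : z ∈ parEll x R) (hR : 0 < R) :
    ‖z.2 - x.2‖ ≤ R ∧ |z.1 - x.1| ≤ R ^ 2 := by
  have h : 0 ≤ cut x R z := hz
  unfold cut at h
  have h1 : 0 ≤ (R ^ 2)⁻¹ * ‖z.2 - x.2‖ ^ 2 := by positivity
  have h2 : 0 ≤ (R ^ 4)⁻¹ * (z.1 - x.1) ^ 2 := by positivity
  constructor
  · have h3 : (R ^ 2)⁻¹ * ‖z.2 - x.2‖ ^ 2 ≤ 1 := by linarith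
    rw [inv_mul_le_iff₀ (by positivity), mul_one] at h3
    exact (sq_le_sq₀ (norm_nonneg _) hR.le).1 h3
  · have h3 : (R ^ 4)⁻¹ * (z.1 - x.1) ^ 2 ≤ 1 := by linarith
    rw [inv_mul_le_iff₀ (by positivity), mul_one] at h3
    refine abs_le_of_sq_le_sq ?_ (by positivity)
    linarith [show (R ^ 2) ^ 2 = R ^ 4 by ring]

lemma parEll_subset_pball {x : SpaceTime d} {R r : ℝ} (hR : 0 < R) (hr : 2 * R < r) :
    parEll x R ⊆ pball x r := fun z hz => by
  obtain ⟨h1, h2⟩ := mem_parEll hz hR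
  have : √|z.1 - x.1| ≤ R := Real.sqrt_le_iff.2 ⟨hR.le, h2⟩
  rw [mem_pball]; unfold pdist; linarith

lemma cut_half {x z : SpaceTime d} {R : ℝ} (hR : 0 < R) (hz : z ∈ parEll x (R / 2)) :
    3 / 4 ≤ cut x R z := by
  have h : 0 ≤ cut x (R / 2) z := hz
  unfold cut at *
  have e1 : ((R / 2) ^ 2)⁻¹ = 4 * (R ^ 2)⁻¹ := by field_simp; norm_num
  have e2 : ((R / 2) ^ 4)⁻¹ = 16 * (R ^ 4)⁻¹ := by field_simp; norm_num
  rw [e1, e2] at h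
  have h2 : 0 ≤ (R ^ 4)⁻¹ * (z.1 - x.1) ^ 2 := by positivity
  nlinarith

lemma parEll_half_subset {x : SpaceTime d} {R : ℝ} (hR : 0 < R) :
    parEll x (R / 2) ⊆ parEll x R := fun z hz => by
  have := cut_half hR hz
  change 0 ≤ cut x R z
  linarith

lemma pball_subset_parEll {x : SpaceTime d} {R : ℝ} (hR : 0 < R) :
    pball x (R / 2) ⊆ parEll x R := fun z hz => by
  have hz' : pdist z x < R / 2 := hz
  have h1 := norm_snd_sub_le_pdist z x
  have h2 := abs_fst_sub_le_pdist_sq z x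
  have h0 := pdist_nonneg z x
  have h3 : ‖z.2 - x.2‖ ^ 2 ≤ (R / 2) ^ 2 := by gcongr; linarith
  have h4 : |z.1 - x.1| ≤ (R / 2) ^ 2 := h2.trans (by gcongr)
  have h5 : (z.1 - x.1) ^ 2 ≤ ((R / 2) ^ 2) ^ 2 := by rw [← sq_abs]; gcongr
  have h6 : (R ^ 2)⁻¹ * ‖z.2 - x.2‖ ^ 2 ≤ 1 / 4 := by
    rw [inv_mul_le_iff₀ (by positivity)]; linarith
  have h7 : (R ^ 4)⁻¹ * (z.1 - x.1) ^ 2 ≤ 1 / 16 := by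
    rw [inv_mul_le_iff₀ (by positivity)]
    linarith [show ((R / 2) ^ 2) ^ 2 = R ^ 4 * (1 / 16) by ring]
  change 0 ≤ cut x R z
  unfold cut; linarith

lemma isCompact_parEll (x : SpaceTime d) {R : ℝ} (hR : 0 < R) : IsCompact (parEll x R) := by
  refine (isCompact_closed_pball x (3 * R)).of_isClosed_subset
    (isClosed_le continuous_const (contDiff_cut x R).continuous) fun z hz => ?_
  exact (mem_pball.1 (parEll_subset_pball hR (by linarith : 2 * R < 3 * R) hz)).le

lemma self_mem_parEll (x : SpaceTime d) (R : ℝ) : x ∈ parEll x R := by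
  change 0 ≤ cut x R x
  simp [cut]

/-- The gradient of the cut-off has length at most `2 / R`. -/
lemma sum_sq_dirD_cut_le {x z : SpaceTime d} {R : ℝ} (hR : 0 < R) (hz : z ∈ parEll x R) :
    ∑ i, dirD (bas i) (cut x R) z ^ 2 ≤ 4 / R ^ 2 := by
  have h1 := (mem_parEll hz hR).1
  have h2 : ∑ i, dirD (bas i) (cut x R) z ^ 2 = 4 * (R ^ 4)⁻¹ * ‖z.2 - x.2‖ ^ 2 := by
    rw [EuclideanSpace.real_norm_sq_eq, Finset.mul_sum]
    refine Finset.sum_congr rfl fun i _ => ?_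
    rw [dirD_bas_cut]
    field_simp
    ring
  rw [h2]
  calc 4 * (R ^ 4)⁻¹ * ‖z.2 - x.2‖ ^ 2 ≤ 4 * (R ^ 4)⁻¹ * R ^ 2 := by gcongr
    _ = 4 / R ^ 2 := by field_simp

lemma heatD_cut_le {x z : SpaceTime d} {R a : ℝ} (hR : 0 < R) (hz : z ∈ parEll x R) :
    heatD a (cut x R) z ≤ (2 + 2 * a * d) / R ^ 2 := by
  have h1 := (mem_parEll hz hR).2
  simp only [heatD, dirD_tdir_cut, dirD_bas_bas_cut, Finset.sum_const, Finset.card_univ,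
    Fintype.card_fin, nsmul_eq_mul]
  have h2 : -(R ^ 4)⁻¹ * (2 * (z.1 - x.1)) ≤ (R ^ 4)⁻¹ * (2 * R ^ 2) := by
    rw [neg_mul, ← mul_neg]
    gcongr
    linarith [neg_abs_le (z.1 - x.1)]
  calc _ ≤ (R ^ 4)⁻¹ * (2 * R ^ 2) - a * (d * (-(R ^ 2)⁻¹ * 2)) := by gcongr
    _ = _ := by field_simp; ring

/-- The constant `k` in the Bernstein function `ζ² (∂_e h)² + k R⁻² h²`, chosen so large that the
good term `-2 a k R⁻² |∇h|²` beats everything produced by the cut-off. -/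
noncomputable def bernK (d : ℕ) (Λ : ℝ) : ℝ := (3 + 2 * Λ⁻¹ * d + 12 * Λ⁻¹) / Λ

/-- At an interior maximum of the Bernstein function the derivative is controlled: this is the
maximum principle combined with the product rule for the heat operator. -/
lemma bernstein_at_max {Λ a : ℝ} (hΛ : 0 < Λ) (ha : a ∈ Set.Icc Λ Λ⁻¹)
    {h : SpaceTime d → ℝ} (hh : ContDiff ℝ ∞ h) {e : EuclideanSpace ℝ (Fin d)} (he : ‖e‖ = 1)
    {x z : SpaceTime d} {R H : ℝ} (hR : 0 < R) (hH : 0 ≤ H) (hz : z ∈ parEll x R)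
    (h0 : |h z| ≤ H) (h1 : |heatD a h z| ≤ H / R ^ 2)
    (h2 : |heatD a (dirD (spc e) h) z| ≤ H / R ^ 3)
    (hmax : IsLocalMax ((cut x R * dirD (spc e) h) * (cut x R * dirD (spc e) h)
      + (bernK d Λ / R ^ 2) • (h * h)) z) :
    dirD (spc e) h z ^ 2 ≤ (1 + 2 * bernK d Λ) * (H / R) ^ 2 := by
  set q := dirD (spc e) h with hq
  set ζ := cut x R with hζ
  set k := bernK d Λ with hk
  have hq' : ContDiff ℝ ∞ q := contDiff_dirD hh _
  have hζ' : ContDiff ℝ ∞ ζ := contDiff_cut x R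
  have hP : ContDiff ℝ ∞ (ζ * q) := hζ'.mul hq'
  have ha0 : 0 < a := hΛ.trans_le ha.1
  have hkk : Λ * k = 3 + 2 * Λ⁻¹ * d + 12 * Λ⁻¹ := by
    rw [hk, bernK]; field_simp
  have hk0 : 0 ≤ k := by rw [hk, bernK]; positivity
  have hPP : ContDiff ℝ ∞ ((ζ * q) * (ζ * q)) := hP.mul hP
  have hhh : ContDiff ℝ ∞ (h * h) := hh.mul hh
  have hkh : ContDiff ℝ ∞ ((k / R ^ 2) • (h * h)) := hhh.const_smul (k / R ^ 2)
  have hWs : ContDiff ℝ ∞ ((ζ * q) * (ζ * q) + (k / R ^ 2) • (h * h)) := hPP.add hkh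
  have hmain := heatD_nonneg_of_isLocalMax hWs hmax ha0.le
  rw [heatD_add hPP hkh, heatD_const_smul hhh,
    heatD_mul hP hP, heatD_mul hh hh, heatD_mul hζ' hq'] at hmain
  have hPi : ∀ i : Fin d, dirD (bas i) (ζ * q) z
      = ζ z * dirD (bas i) q z + dirD (bas i) ζ z * q z := fun i => by
    rw [dirD_mul hζ' hq']; rfl
  simp only [hPi, Pi.mul_apply] at hmain
  have hζ0 : 0 ≤ ζ z := hz
  have hζ1 : ζ z ≤ 1 := by
    rw [hζ, cut]
    have h1 : 0 ≤ (R ^ 2)⁻¹ * ‖z.2 - x.2‖ ^ 2 := by positivity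
    have h2 : 0 ≤ (R ^ 4)⁻¹ * (z.1 - x.1) ^ 2 := by positivity
    linarith
  -- completing the square absorbs the mixed terms `ζ q ∂ᵢζ ∂ᵢq`
  have hsq : -(4 * (ζ z * q z) * ∑ i, dirD (bas i) ζ z * dirD (bas i) q z)
      - 2 * ∑ i, (ζ z * dirD (bas i) q z + dirD (bas i) ζ z * q z)
        * (ζ z * dirD (bas i) q z + dirD (bas i) ζ z * q z)
      ≤ 6 * q z ^ 2 * ∑ i, dirD (bas i) ζ z ^ 2 := by
    rw [Finset.mul_sum, Finset.mul_sum, Finset.mul_sum, ← Finset.sum_neg_distrib,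
      ← Finset.sum_sub_distrib]
    refine Finset.sum_le_sum fun i _ => ?_
    nlinarith [sq_nonneg (ζ z * dirD (bas i) q z + 2 * (dirD (bas i) ζ z * q z))]
  have hsum := sum_sq_dirD_cut_le hR hz
  have hLz := heatD_cut_le (a := a) hR hz
  have hgrad := sum_sq_dirD_bas_ge (F := h) he z
  rw [← hq] at hgrad
  simp only [← pow_two (dirD _ h z)] at hmain
  have hqn : (0 : ℝ) ≤ q z ^ 2 := sq_nonneg _
  -- the five contributions, each bounded by a multiple of `q² / R²` or `H² / R⁴`
  have t1 : 2 * (ζ z ^ 2 * (q z * heatD a q z)) ≤ q z ^ 2 / R ^ 2 + H ^ 2 / R ^ 4 := by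
    have b1 : q z * heatD a q z ≤ |q z| * (H / R ^ 3) := by
      refine (le_abs_self _).trans ?_
      rw [abs_mul]
      gcongr
    have b2 : 2 * (|q z| * (H / R ^ 3)) ≤ q z ^ 2 / R ^ 2 + H ^ 2 / R ^ 4 := by
      have e : q z ^ 2 / R ^ 2 + H ^ 2 / R ^ 4 - 2 * (|q z| * (H / R ^ 3))
          = (|q z| / R - H / R ^ 2) ^ 2 := by
        rw [← sq_abs (q z)]; field_simp; ring
      linarith [sq_nonneg (|q z| / R - H / R ^ 2)]
    have b3 : ζ z ^ 2 * (q z * heatD a q z) ≤ |q z| * (H / R ^ 3) := by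
      have : 0 ≤ |q z| * (H / R ^ 3) := by positivity
      calc ζ z ^ 2 * (q z * heatD a q z) ≤ ζ z ^ 2 * (|q z| * (H / R ^ 3)) := by gcongr
        _ ≤ 1 * (|q z| * (H / R ^ 3)) := by gcongr; exact pow_le_one₀ hζ0 hζ1
        _ = _ := one_mul _
    linarith
  have t2 : 2 * (ζ z * q z ^ 2 * heatD a ζ z) ≤ q z ^ 2 * ((4 + 4 * Λ⁻¹ * d) / R ^ 2) := by
    have b0 : (2 + 2 * a * d) / R ^ 2 ≤ (2 + 2 * Λ⁻¹ * d) / R ^ 2 := by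
      gcongr; exact ha.2
    have b1 : ζ z * heatD a ζ z ≤ (2 + 2 * Λ⁻¹ * d) / R ^ 2 := by
      have : 0 ≤ (2 + 2 * Λ⁻¹ * d) / R ^ 2 := by positivity
      calc ζ z * heatD a ζ z ≤ ζ z * ((2 + 2 * Λ⁻¹ * d) / R ^ 2) := by gcongr; exact hLz.trans b0
        _ ≤ 1 * ((2 + 2 * Λ⁻¹ * d) / R ^ 2) := by gcongr
        _ = _ := one_mul _
    calc 2 * (ζ z * q z ^ 2 * heatD a ζ z) = 2 * q z ^ 2 * (ζ z * heatD a ζ z) := by ring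
      _ ≤ 2 * q z ^ 2 * ((2 + 2 * Λ⁻¹ * d) / R ^ 2) := by gcongr
      _ = _ := by ring
  have t3 : a * (6 * q z ^ 2 * ∑ i, dirD (bas i) ζ z ^ 2) ≤ q z ^ 2 * (24 * Λ⁻¹ / R ^ 2) := by
    calc a * (6 * q z ^ 2 * ∑ i, dirD (bas i) ζ z ^ 2)
        ≤ Λ⁻¹ * (6 * q z ^ 2 * (4 / R ^ 2)) := by gcongr; exact ha.2
      _ = _ := by ring
  have t4 : k / R ^ 2 * (2 * (h z * heatD a h z)) ≤ 2 * k * (H ^ 2 / R ^ 4) := by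
    have b1 : h z * heatD a h z ≤ H * (H / R ^ 2) := by
      refine (le_abs_self _).trans ?_
      rw [abs_mul]
      gcongr
    calc k / R ^ 2 * (2 * (h z * heatD a h z)) ≤ k / R ^ 2 * (2 * (H * (H / R ^ 2))) := by gcongr
      _ = _ := by field_simp
  have t5 : (3 + 2 * Λ⁻¹ * d + 12 * Λ⁻¹) * (q z ^ 2 / R ^ 2)
      ≤ k / R ^ 2 * (a * ∑ i, dirD (bas i) h z ^ 2) := by
    calc (3 + 2 * Λ⁻¹ * d + 12 * Λ⁻¹) * (q z ^ 2 / R ^ 2) = k / R ^ 2 * (Λ * q z ^ 2) := by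
          rw [← hkk]; ring
      _ ≤ _ := by gcongr; exact ha.1
  have t6 := mul_le_mul_of_nonneg_left hsq ha0.le
  have hS : 0 ≤ k / R ^ 2 * (a * ∑ i, dirD (bas i) h z ^ 2) := by positivity
  have hfin : q z ^ 2 / R ^ 2 ≤ (1 + 2 * k) * (H ^ 2 / R ^ 4) := by
    have e1 : q z ^ 2 * ((4 + 4 * Λ⁻¹ * d) / R ^ 2)
        = (4 + 4 * Λ⁻¹ * d) * (q z ^ 2 / R ^ 2) := by ring
    have e2 : q z ^ 2 * (24 * Λ⁻¹ / R ^ 2) = 24 * Λ⁻¹ * (q z ^ 2 / R ^ 2) := by ring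
    rw [e1] at t2
    rw [e2] at t3
    linear_combination hmain + t1 + t2 + t3 + t4 + 2 * t5 + t6
  have e3 : q z ^ 2 = R ^ 2 * (q z ^ 2 / R ^ 2) := by field_simp
  rw [e3]
  calc R ^ 2 * (q z ^ 2 / R ^ 2) ≤ R ^ 2 * ((1 + 2 * k) * (H ^ 2 / R ^ 4)) := by gcongr
    _ = _ := by field_simp

/-- **Bernstein's interior gradient estimate** for `∂_t - a Δ`, in scale-invariant form. -/
lemma bernstein {Λ a : ℝ} (hΛ : 0 < Λ) (ha : a ∈ Set.Icc Λ Λ⁻¹)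
    {h : SpaceTime d → ℝ} (hh : ContDiff ℝ ∞ h) {e : EuclideanSpace ℝ (Fin d)} (he : ‖e‖ = 1)
    {x : SpaceTime d} {R H : ℝ} (hR : 0 < R) (hH : 0 ≤ H)
    (h0 : ∀ z ∈ parEll x R, |h z| ≤ H) (h1 : ∀ z ∈ parEll x R, |heatD a h z| ≤ H / R ^ 2)
    (h2 : ∀ z ∈ parEll x R, |heatD a (dirD (spc e) h) z| ≤ H / R ^ 3)
    {y : SpaceTime d} (hy : y ∈ parEll x (R / 2)) :
    |dirD (spc e) h y| ≤ (2 + 6 * bernK d Λ) * H / R := by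
  set k := bernK d Λ with hk
  have hk0 : 0 ≤ k := by rw [hk, bernK]; positivity
  set q := dirD (spc e) h with hq
  set W : SpaceTime d → ℝ := (cut x R * q) * (cut x R * q) + (k / R ^ 2) • (h * h) with hW
  have hq' : ContDiff ℝ ∞ q := contDiff_dirD hh _
  have hWs : ContDiff ℝ ∞ W :=
    (((contDiff_cut x R).mul hq').mul ((contDiff_cut x R).mul hq')).add
      ((hh.mul hh).const_smul (k / R ^ 2))
  have hWz : ∀ z, W z = cut x R z ^ 2 * q z ^ 2 + k / R ^ 2 * h z ^ 2 := fun z => by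
    simp only [hW, Pi.add_apply, Pi.mul_apply, Pi.smul_apply, smul_eq_mul]; ring
  obtain ⟨z, hz, hzmax⟩ := (isCompact_parEll x hR).exists_isMaxOn ⟨x, self_mem_parEll x R⟩
    hWs.continuous.continuousOn
  have hhz : k / R ^ 2 * h z ^ 2 ≤ k * (H / R) ^ 2 := by
    have : h z ^ 2 ≤ H ^ 2 := by rw [← sq_abs]; gcongr; exact h0 z hz
    calc k / R ^ 2 * h z ^ 2 ≤ k / R ^ 2 * H ^ 2 := by gcongr
      _ = _ := by ring
  have hWmax : W z ≤ (1 + 3 * k) * (H / R) ^ 2 := by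
    rw [hWz]
    have hcz : 0 ≤ cut x R z := hz
    rcases hcz.eq_or_lt with h3 | h3
    · rw [← h3]
      have : 0 ≤ (1 + 2 * k) * (H / R) ^ 2 := by positivity
      linarith
    · have hloc : IsLocalMax W z := by
        refine hzmax.isLocalMax ?_
        filter_upwards [(isOpen_lt continuous_const (contDiff_cut x R).continuous).mem_nhds h3]
          with w hw
        exact le_of_lt hw
      have hb := bernstein_at_max hΛ ha hh he hR hH hz (h0 z hz) (h1 z hz) (h2 z hz) hloc
      have hc1 : cut x R z ≤ 1 := by
        have h1 : 0 ≤ (R ^ 2)⁻¹ * ‖z.2 - x.2‖ ^ 2 := by positivity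
        have h2 : 0 ≤ (R ^ 4)⁻¹ * (z.1 - x.1) ^ 2 := by positivity
        rw [cut]; linarith
      have : cut x R z ^ 2 * q z ^ 2 ≤ 1 * q z ^ 2 := by
        gcongr
        exact pow_le_one₀ hcz hc1
      linarith
  have hWy : W y ≤ W z := hzmax (parEll_half_subset hR hy)
  have hcy := cut_half hR hy
  rw [hWz y] at hWy
  have h4 : 0 ≤ k / R ^ 2 * h y ^ 2 := by positivity
  have h5 : (3 / 4) ^ 2 * q y ^ 2 ≤ cut x R y ^ 2 * q y ^ 2 := by gcongr
  have h6 : q y ^ 2 ≤ ((2 + 6 * k) * H / R) ^ 2 := by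
    have e : ((2 + 6 * k) * H / R) ^ 2 = (2 + 6 * k) ^ 2 * (H / R) ^ 2 := by ring
    rw [e]
    have : 2 * (1 + 3 * k) * (H / R) ^ 2 ≤ (2 + 6 * k) ^ 2 * (H / R) ^ 2 := by
      gcongr
      nlinarith
    nlinarith [sq_nonneg (q y)]
  exact abs_le_of_sq_le_sq h6 (by positivity)

/-! ### Parabolic mollification -/

instance : (volume : Measure (SpaceTime d)).IsAddHaarMeasure :=
  inferInstanceAs ((volume : Measure ℝ).prod
    (volume : Measure (EuclideanSpace ℝ (Fin d)))).IsAddHaarMeasure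

/-- A smooth kernel supported in the parabolic unit ball. Unlike `IsSymmKernel`, this notion is
stable under differentiation. -/
structure IsKernel (k : SpaceTime d → ℝ) : Prop where
  smooth : ContDiff ℝ ∞ k
  hasCompactSupport : HasCompactSupport k
  tsupport_subset : tsupport k ⊆ pball 0 1

lemma IsSymmKernel.isKernel {ρ : SpaceTime d → ℝ} (h : IsSymmKernel ρ) : IsKernel ρ :=
  ⟨h.smooth, h.hasCompactSupport, h.tsupport_subset⟩

lemma tsupport_dirD_subset (w : SpaceTime d) (F : SpaceTime d → ℝ) :
    tsupport (dirD w F) ⊆ tsupport F := by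
  refine (closure_mono fun z hz => ?_).trans (tsupport_fderiv_subset ℝ (f := F))
  intro h
  exact hz (by simp [dirD, h])

lemma hasCompactSupport_dirD {F : SpaceTime d → ℝ} (hF : HasCompactSupport F)
    (w : SpaceTime d) : HasCompactSupport (dirD w F) :=
  hF.of_isClosed_subset (isClosed_tsupport _) (tsupport_dirD_subset w F)

lemma IsKernel.dirD {k : SpaceTime d → ℝ} (hk : IsKernel k) (w : SpaceTime d) :
    IsKernel (dirD w k) :=
  ⟨contDiff_dirD hk.smooth w, hasCompactSupport_dirD hk.hasCompactSupport w,
    (tsupport_dirD_subset w k).trans hk.tsupport_subset⟩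

/-- The parabolic dilation `(t, x) ↦ (lam⁻² t, lam⁻¹ x)`. -/
noncomputable def dil (lam : ℝ) : SpaceTime d →L[ℝ] SpaceTime d :=
  ((lam ^ 2)⁻¹ • ContinuousLinearMap.fst ℝ ℝ (EuclideanSpace ℝ (Fin d))).prod
    (lam⁻¹ • ContinuousLinearMap.snd ℝ ℝ (EuclideanSpace ℝ (Fin d)))

lemma rescale_eq_comp_dil (k : SpaceTime d → ℝ) (lam : ℝ) :
    rescale k lam = fun z => (lam ^ (d + 2))⁻¹ * k (dil lam z) := rfl

lemma contDiff_rescale {k : SpaceTime d → ℝ} (hk : ContDiff ℝ ∞ k) (lam : ℝ) :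
    ContDiff ℝ ∞ (rescale k lam) := by
  rw [rescale_eq_comp_dil]
  exact contDiff_const.mul (hk.comp (dil lam).contDiff)

lemma pdist_dil {lam : ℝ} (hl : 0 < lam) (z : SpaceTime d) :
    pdist (dil lam z) 0 = lam⁻¹ * pdist z 0 := by
  simp [pdist, dil, abs_mul, norm_smul, abs_of_pos hl]
  rw [Real.sqrt_sq hl.le]
  ring

lemma pdist_lt_of_rescale_ne_zero {k : SpaceTime d → ℝ} (hk : tsupport k ⊆ pball 0 1) {lam : ℝ}
    (hl : 0 < lam) {z : SpaceTime d} (hz : rescale k lam z ≠ 0) : pdist z 0 < lam := by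
  have h1 : k (dil lam z) ≠ 0 := fun h => hz (by rw [rescale_eq_comp_dil]; simp [h])
  have h2 : pdist (dil lam z) 0 < 1 := hk (subset_tsupport _ h1)
  rwa [pdist_dil hl, inv_mul_lt_iff₀ hl, mul_one] at h2

lemma hasCompactSupport_rescale {k : SpaceTime d → ℝ} (hk : tsupport k ⊆ pball 0 1) {lam : ℝ}
    (hl : 0 < lam) : HasCompactSupport (rescale k lam) := by
  refine HasCompactSupport.intro (isCompact_closed_pball 0 lam) fun z hz => ?_
  by_contra h
  exact hz (pdist_lt_of_rescale_ne_zero hk hl h).le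

lemma integral_rescale {k : SpaceTime d → ℝ} (hk : Continuous k) (hs : HasCompactSupport k)
    (hk1 : tsupport k ⊆ pball 0 1) {lam : ℝ} (hl : 0 < lam) :
    ∫ z, rescale k lam z = ∫ z, k z := by
  have hc : Continuous (rescale k lam) := by
    rw [rescale_eq_comp_dil]
    exact continuous_const.mul (hk.comp (dil lam).continuous)
  have h1 := hc.integrable_of_hasCompactSupport (μ := volume) (hasCompactSupport_rescale hk1 hl)
  have h2 := hk.integrable_of_hasCompactSupport (μ := volume) hs
  rw [Measure.volume_eq_prod] at h1 h2 ⊢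
  rw [integral_prod _ h1, integral_prod _ h2]
  simp only [rescale, integral_const_mul]
  have h3 : ∀ t : ℝ, ∫ x : EuclideanSpace ℝ (Fin d), k ((lam ^ 2)⁻¹ * t, lam⁻¹ • x)
      = lam ^ d * ∫ x : EuclideanSpace ℝ (Fin d), k ((lam ^ 2)⁻¹ * t, x) := by
    intro t
    rw [Measure.integral_comp_inv_smul volume
      (fun x : EuclideanSpace ℝ (Fin d) => k ((lam ^ 2)⁻¹ * t, x)) lam]
    simp [abs_of_pos hl]
  simp only [h3, integral_const_mul]
  rw [Measure.integral_comp_inv_mul_left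
    (fun t : ℝ => ∫ x : EuclideanSpace ℝ (Fin d), k (t, x)) (lam ^ 2)]
  rw [abs_of_pos (by positivity), smul_eq_mul, ← mul_assoc, ← mul_assoc, pow_add]
  field_simp

lemma dirD_spc_rescale {k : SpaceTime d → ℝ} (hk : ContDiff ℝ ∞ k) (lam : ℝ)
    (e : EuclideanSpace ℝ (Fin d)) :
    dirD (spc e) (rescale k lam) = lam⁻¹ • rescale (dirD (spc e) k) lam := by
  funext z
  have h := ((differentiable_of_smooth hk (dil lam z)).hasFDerivAt.comp z
    (dil lam).hasFDerivAt).const_mul (lam ^ (d + 2))⁻¹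
  have h2 : dil lam (spc e) = lam⁻¹ • spc (d := d) e := by simp [dil, spc]
  have h3 : fderiv ℝ (rescale k lam) z = _ := h.fderiv
  rw [dirD, h3, smul_apply, ContinuousLinearMap.comp_apply, h2, map_smul]
  simp only [rescale_eq_comp_dil, dirD, Pi.smul_apply, smul_eq_mul]
  ring

lemma dirD_tdir_rescale {k : SpaceTime d → ℝ} (hk : ContDiff ℝ ∞ k) (lam : ℝ) :
    dirD tdir (rescale k lam) = (lam ^ 2)⁻¹ • rescale (dirD tdir k) lam := by
  funext z
  have h := ((differentiable_of_smooth hk (dil lam z)).hasFDerivAt.comp z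
    (dil lam).hasFDerivAt).const_mul (lam ^ (d + 2))⁻¹
  have h2 : dil lam tdir = (lam ^ 2)⁻¹ • tdir (d := d) := by simp [dil, tdir]
  have h3 : fderiv ℝ (rescale k lam) z = _ := h.fderiv
  rw [dirD, h3, smul_apply, ContinuousLinearMap.comp_apply, h2, map_smul]
  simp only [rescale_eq_comp_dil, dirD, Pi.smul_apply, smul_eq_mul]
  ring

lemma mollify_eq_convolution (k : SpaceTime d → ℝ) (lam : ℝ) (F : SpaceTime d → ℝ) :
    mollify k lam F
      = convolution F (rescale k lam) (ContinuousLinearMap.mul ℝ ℝ) volume := rfl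

lemma contDiff_mollify {k : SpaceTime d → ℝ} (hk : IsKernel k) {lam : ℝ} (hl : 0 < lam)
    {F : SpaceTime d → ℝ} (hF : LocallyIntegrable F) : ContDiff ℝ ∞ (mollify k lam F) := by
  rw [mollify_eq_convolution]
  exact (hasCompactSupport_rescale hk.tsupport_subset hl).contDiff_convolution_right _ hF
    (contDiff_rescale hk.smooth lam)

lemma hasCompactSupport_mollify {k : SpaceTime d → ℝ} (hk : IsKernel k) {lam : ℝ} (hl : 0 < lam)
    {F : SpaceTime d → ℝ} (hF : HasCompactSupport F) : HasCompactSupport (mollify k lam F) := by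
  rw [mollify_eq_convolution]
  exact hF.convolution _ (hasCompactSupport_rescale hk.tsupport_subset hl)

lemma dirD_mollify {k : SpaceTime d → ℝ} (hk : IsKernel k) {lam : ℝ} (hl : 0 < lam)
    {F : SpaceTime d → ℝ} (hF : LocallyIntegrable F) (w z : SpaceTime d) :
    dirD w (mollify k lam F) z = ∫ y, F y * dirD w (rescale k lam) (z - y) := by
  have hc := hasCompactSupport_rescale hk.tsupport_subset hl
  have hs := contDiff_rescale hk.smooth lam
  have h := hc.hasFDerivAt_convolution_right (ContinuousLinearMap.mul ℝ ℝ) hF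
    (hs.of_le (by simp)) z
  rw [dirD, mollify_eq_convolution, h.fderiv,
    convolution_precompR_apply _ hF (hc.fderiv ℝ) (hs.continuous_fderiv (by simp))]
  rfl

lemma dirD_spc_mollify {k : SpaceTime d → ℝ} (hk : IsKernel k) {lam : ℝ} (hl : 0 < lam)
    {F : SpaceTime d → ℝ} (hF : LocallyIntegrable F) (e : EuclideanSpace ℝ (Fin d)) :
    dirD (spc e) (mollify k lam F) = lam⁻¹ • mollify (dirD (spc e) k) lam F := by
  funext z
  rw [dirD_mollify hk hl hF, dirD_spc_rescale hk.smooth]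
  simp only [mollify, Pi.smul_apply, smul_eq_mul, ← integral_const_mul]
  congr 1; funext y; ring

lemma dirD_tdir_mollify {k : SpaceTime d → ℝ} (hk : IsKernel k) {lam : ℝ} (hl : 0 < lam)
    {F : SpaceTime d → ℝ} (hF : LocallyIntegrable F) :
    dirD tdir (mollify k lam F) = (lam ^ 2)⁻¹ • mollify (dirD tdir k) lam F := by
  funext z
  rw [dirD_mollify hk hl hF, dirD_tdir_rescale hk.smooth]
  simp only [mollify, Pi.smul_apply, smul_eq_mul, ← integral_const_mul]
  congr 1; funext y; ring

lemma dirD_mollify_left {k : SpaceTime d → ℝ} (hk : IsKernel k) {lam : ℝ} (hl : 0 < lam)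
    {f : SpaceTime d → ℝ} (hf : ContDiff ℝ ∞ f) (hfc : HasCompactSupport f) (w : SpaceTime d) :
    dirD w (mollify k lam f) = mollify k lam (dirD w f) := by
  funext z
  have hc := hasCompactSupport_rescale hk.tsupport_subset hl
  have hg : LocallyIntegrable (rescale k lam) (volume : Measure (SpaceTime d)) :=
    (contDiff_rescale hk.smooth lam).continuous.locallyIntegrable
  have h := hfc.hasFDerivAt_convolution_left (ContinuousLinearMap.mul ℝ ℝ)
    (hf.of_le (by simp)) hg z
  rw [dirD, mollify_eq_convolution, h.fderiv, mollify_eq_convolution]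
  have h2 := (hfc.fderiv ℝ).convolutionExists_left
    ((ContinuousLinearMap.mul ℝ ℝ).precompL (SpaceTime d)) (hf.continuous_fderiv (by simp)) hg z
  rw [convolution_def, convolution_def, ContinuousLinearMap.integral_apply h2]
  rfl

lemma integrable_mul_rescale {k : SpaceTime d → ℝ} (hk : IsKernel k) {lam : ℝ} (hl : 0 < lam)
    {F : SpaceTime d → ℝ} (hF : LocallyIntegrable F) (x : SpaceTime d) :
    Integrable fun y => F y * rescale k lam (x - y) := by
  have h := (hasCompactSupport_rescale hk.tsupport_subset hl).convolutionExists_right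
    (ContinuousLinearMap.mul ℝ ℝ) hF (contDiff_rescale hk.smooth lam).continuous x
  exact h

lemma mollify_sub {k : SpaceTime d → ℝ} (hk : IsKernel k) {lam : ℝ} (hl : 0 < lam)
    {F G : SpaceTime d → ℝ} (hF : LocallyIntegrable F) (hG : LocallyIntegrable G)
    (x : SpaceTime d) :
    mollify k lam (fun y => F y - G y) x = mollify k lam F x - mollify k lam G x := by
  simp only [mollify, sub_mul]
  exact integral_sub (integrable_mul_rescale hk hl hF x) (integrable_mul_rescale hk hl hG x)

lemma heatD_mollify {k : SpaceTime d → ℝ} (hk : IsKernel k) {lam : ℝ} (hl : 0 < lam)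
    {f : SpaceTime d → ℝ} (hf : ContDiff ℝ ∞ f) (hfc : HasCompactSupport f) (a : ℝ) :
    heatD a (mollify k lam f) = mollify k lam (heatD a f) := by
  funext z
  have h1 : ∀ i, ContDiff ℝ ∞ (dirD (bas i) (dirD (bas i) f)) :=
    fun i => contDiff_dirD (contDiff_dirD hf _) _
  simp only [heatD, dirD_mollify_left hk hl hf hfc,
    dirD_mollify_left hk hl (contDiff_dirD hf _) (hasCompactSupport_dirD hfc _)]
  have h2 : Continuous fun z => a * ∑ i, dirD (bas i) (dirD (bas i) f) z :=
    continuous_const.mul (continuous_finsetSum _ fun i _ => (h1 i).continuous)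
  have h3 := mollify_sub hk hl (contDiff_dirD hf tdir).continuous.locallyIntegrable
    h2.locallyIntegrable z
  change _ = mollify k lam (fun z => dirD tdir f z - a * ∑ i, dirD (bas i) (dirD (bas i) f) z) z
  rw [h3]
  congr 1
  simp only [mollify]
  rw [← integral_finsetSum _
    fun i _ => integrable_mul_rescale hk hl (h1 i).continuous.locallyIntegrable z,
    ← integral_const_mul]
  congr 1; funext y
  rw [Finset.mul_sum, Finset.mul_sum, Finset.sum_mul]
  exact Finset.sum_congr rfl fun i _ => by ring

lemma abs_mollify_le {k : SpaceTime d → ℝ} (hk : IsKernel k) {lam : ℝ} (hl : 0 < lam)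
    {F : SpaceTime d → ℝ} {y : SpaceTime d} {B : ℝ} (hB : ∀ z ∈ pball y lam, |F z| ≤ B) :
    |mollify k lam F y| ≤ (∫ z, |k z|) * B := by
  have hkc : Continuous fun z => |k z| := hk.smooth.continuous.abs
  have hs : HasCompactSupport fun z => |k z| := hk.hasCompactSupport.abs
  have ht : tsupport (fun z => |k z|) ⊆ pball 0 1 := by
    refine (closure_mono fun z hz => ?_).trans hk.tsupport_subset
    simpa using hz
  have hr : ∀ z, rescale (fun z => |k z|) lam z = |rescale k lam z| := fun z => by
    simp only [rescale, abs_mul]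
    rw [abs_of_pos (a := (lam ^ (d + 2))⁻¹) (by positivity)]
  have hint : Integrable fun z => |rescale k lam z| :=
    ((contDiff_rescale hk.smooth lam).continuous.integrable_of_hasCompactSupport
      (hasCompactSupport_rescale hk.tsupport_subset hl)).abs
  have h1 : ∫ z, |k z| = ∫ z, |rescale k lam (y - z)| := by
    rw [integral_sub_left_eq_self (fun z => |rescale k lam z|) volume y]
    rw [← integral_rescale hkc hs ht hl]
    simp only [hr]
  rw [h1, ← integral_mul_const, ← Real.norm_eq_abs]
  refine norm_integral_le_of_norm_le ((hint.comp_sub_left y).mul_const B)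
    (Filter.Eventually.of_forall fun z => ?_)
  rw [norm_mul, Real.norm_eq_abs, Real.norm_eq_abs, mul_comm]
  by_cases hz : rescale k lam (y - z) = 0
  · simp [hz]
  · gcongr
    refine hB z ?_
    have := pdist_lt_of_rescale_ne_zero hk.tsupport_subset hl hz
    rw [mem_pball, pdist_comm]
    simpa [pdist] using this

/-- Mollification by a kernel that is even in space reproduces spatially affine functions, up to
the mass of the kernel. -/
lemma mollify_affine {ρ : SpaceTime d → ℝ} (hρ : IsSymmKernel ρ) {lam : ℝ} (hl : 0 < lam)
    (c₀ : ℝ) (ν₀ p : EuclideanSpace ℝ (Fin d)) (y : SpaceTime d) :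
    mollify ρ lam (fun z => c₀ + inner ℝ ν₀ (z.2 - p)) y
      = (∫ z, ρ z) * (c₀ + inner ℝ ν₀ (y.2 - p)) := by
  have hk := hρ.isKernel
  have hc := hasCompactSupport_rescale hk.tsupport_subset hl
  have hs := (contDiff_rescale hk.smooth lam).continuous
  have h1 : mollify ρ lam (fun z => c₀ + inner ℝ ν₀ (z.2 - p)) y
      = ∫ z, (c₀ + inner ℝ ν₀ (y.2 - p) - inner ℝ ν₀ z.2) * rescale ρ lam z := by
    rw [mollify_eq_convolution, convolution_mul_swap]
    congr 1; funext z
    congr 1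
    rw [Prod.snd_sub, sub_right_comm, inner_sub_right ν₀ (y.2 - p)]
    ring
  have hint : Integrable (fun z : SpaceTime d => inner ℝ ν₀ z.2 * rescale ρ lam z) :=
    ((continuous_const.inner continuous_snd).mul hs).integrable_of_hasCompactSupport
      hc.mul_left
  have hodd : ∫ z : SpaceTime d, inner ℝ ν₀ z.2 * rescale ρ lam z = 0 := by
    rw [Measure.volume_eq_prod] at hint ⊢
    rw [integral_prod _ hint]
    refine integral_eq_zero_of_ae (Filter.Eventually.of_forall fun t => ?_)
    have h2 := integral_neg_eq_self
      (fun x : EuclideanSpace ℝ (Fin d) => inner ℝ ν₀ x * rescale ρ lam (t, x)) volume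
    have h3 : ∀ x : EuclideanSpace ℝ (Fin d), inner ℝ ν₀ (-x) * rescale ρ lam (t, -x)
        = -(inner ℝ ν₀ x * rescale ρ lam (t, x)) := fun x => by
      simp only [rescale, inner_neg_right, smul_neg]
      rw [← hρ.symm]
      ring
    simp only [h3, integral_neg] at h2
    simp only [Pi.zero_apply]
    linarith
  rw [h1]
  simp only [sub_mul]
  rw [integral_sub ((hs.integrable_of_hasCompactSupport hc).const_mul _) hint, hodd,
    integral_const_mul, integral_rescale hk.smooth.continuous hk.hasCompactSupport
    hk.tsupport_subset hl]
  ring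

/-- Kernels obtained from one kernel by differentiating at most twice have uniformly bounded
`L¹` norms. -/
lemma exists_kernel_bound {ρ : SpaceTime d → ℝ} (hρ : IsKernel ρ) :
    ∃ N : ℝ, 1 ≤ N ∧ (∫ z, |ρ z|) ≤ N ∧ (∫ z, |dirD tdir ρ z|) ≤ N ∧
      ∀ e : EuclideanSpace ℝ (Fin d), ‖e‖ = 1 → (∫ z, |dirD (spc e) ρ z|) ≤ N ∧
        (∫ z, |dirD (spc e) (dirD (spc e) ρ) z|) ≤ N := by
  have hs1 : ContDiff ℝ ∞ (fderiv ℝ ρ) := hρ.smooth.fderiv_right (by simp)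
  have hc1 := hρ.hasCompactSupport.fderiv ℝ
  have hc2 := hc1.fderiv ℝ
  have i1 : Integrable fun z => ‖fderiv ℝ ρ z‖ :=
    (hs1.continuous.integrable_of_hasCompactSupport hc1).norm
  have i2 : Integrable fun z => ‖fderiv ℝ (fderiv ℝ ρ) z‖ :=
    ((hs1.continuous_fderiv (by simp)).integrable_of_hasCompactSupport hc2).norm
  have n1 : 0 ≤ ∫ z, ‖fderiv ℝ ρ z‖ := integral_nonneg fun _ => norm_nonneg _
  have n2 : 0 ≤ ∫ z, ‖fderiv ℝ (fderiv ℝ ρ) z‖ := integral_nonneg fun z => by positivity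
  have n0 : 0 ≤ ∫ z, |ρ z| := integral_nonneg fun _ => abs_nonneg _
  have hspc : ∀ e : EuclideanSpace ℝ (Fin d), ‖spc e‖ = ‖e‖ := fun e => by
    simp [spc, Prod.norm_def]
  have ht : ‖(tdir : SpaceTime d)‖ = 1 := by simp [tdir, Prod.norm_def]
  have b1 : ∀ w : SpaceTime d, ‖w‖ = 1 → (∫ z, |dirD w ρ z|) ≤ ∫ z, ‖fderiv ℝ ρ z‖ := by
    intro w hw
    refine integral_mono_of_nonneg (Filter.Eventually.of_forall fun _ => abs_nonneg _) i1
      (Filter.Eventually.of_forall fun z => ?_)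
    simpa [hw, dirD] using (fderiv ℝ ρ z).le_opNorm w
  have b2 : ∀ w : SpaceTime d, ‖w‖ = 1 →
      (∫ z, |dirD w (dirD w ρ) z|) ≤ ∫ z, ‖fderiv ℝ (fderiv ℝ ρ) z‖ := by
    intro w hw
    refine integral_mono_of_nonneg (Filter.Eventually.of_forall fun _ => abs_nonneg _) i2
      (Filter.Eventually.of_forall fun z => ?_)
    simp only
    rw [dirD_dirD hρ.smooth]
    simpa [hw] using (fderiv ℝ (fderiv ℝ ρ) z).le_opNorm₂ w w
  refine ⟨1 + (∫ z, |ρ z|) + (∫ z, ‖fderiv ℝ ρ z‖) + ∫ z, ‖fderiv ℝ (fderiv ℝ ρ) z‖,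
    by linarith, by linarith, by linarith [b1 _ ht], fun e he => ⟨?_, ?_⟩⟩
  · linarith [b1 _ ((hspc e).trans he)]
  · linarith [b2 _ ((hspc e).trans he)]

/-! ### Interior estimate for mollified solutions -/

/-- The spatially affine function `y ↦ c₀ + ν₀ · (y - p)` on space-time. -/
noncomputable def aff (c₀ : ℝ) (ν₀ p : EuclideanSpace ℝ (Fin d)) (z : SpaceTime d) : ℝ :=
  c₀ + inner ℝ ν₀ (z.2 - p)

lemma contDiff_aff (c₀ : ℝ) (ν₀ p : EuclideanSpace ℝ (Fin d)) : ContDiff ℝ ∞ (aff c₀ ν₀ p) :=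
  contDiff_const.add (contDiff_const.inner ℝ (contDiff_snd.sub contDiff_const))

lemma dirD_spc_aff (c₀ : ℝ) (ν₀ p e : EuclideanSpace ℝ (Fin d)) :
    dirD (spc e) (aff c₀ ν₀ p) = fun _ => inner ℝ ν₀ e := by
  funext z
  have h := hasDerivAt_line (contDiff_aff c₀ ν₀ p) z (spc e) 0
  have h1 : (fun τ : ℝ => aff c₀ ν₀ p (z + τ • spc e))
      = fun τ : ℝ => aff c₀ ν₀ p z + τ * inner ℝ ν₀ e := by
    funext τ
    simp only [aff, spc, Prod.snd_add, Prod.smul_snd]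
    rw [add_sub_right_comm, inner_add_right, inner_smul_right]
    ring
  rw [h1] at h
  have h2 := ((hasDerivAt_id (0 : ℝ)).mul_const (inner ℝ ν₀ e)).const_add (aff c₀ ν₀ p z)
  simp only [id, one_mul] at h2
  simpa using h.unique h2

lemma dirD_const (w : SpaceTime d) (c : ℝ) : dirD w (fun _ => c) = fun _ => 0 := by
  funext z
  simp [dirD]

lemma mollify_aff {ρ : SpaceTime d → ℝ} (hρ : IsSymmKernel ρ) {lam : ℝ} (hl : 0 < lam)
    (c₀ : ℝ) (ν₀ p : EuclideanSpace ℝ (Fin d)) :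
    mollify ρ lam (aff c₀ ν₀ p) = (∫ z, ρ z) • aff c₀ ν₀ p :=
  funext fun y => mollify_affine hρ hl c₀ ν₀ p y

lemma dirD_dirD_spc_mollify {k : SpaceTime d → ℝ} (hk : IsKernel k) {lam : ℝ} (hl : 0 < lam)
    {F : SpaceTime d → ℝ} (hF : LocallyIntegrable F) (e : EuclideanSpace ℝ (Fin d)) :
    dirD (spc e) (dirD (spc e) (mollify k lam F))
      = (lam ^ 2)⁻¹ • mollify (dirD (spc e) (dirD (spc e) k)) lam F := by
  rw [dirD_spc_mollify hk hl hF, dirD_const_smul (contDiff_mollify (hk.dirD _) hl hF),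
    dirD_spc_mollify (hk.dirD _) hl hF, smul_smul]
  congr 1
  rw [sq, mul_inv]

lemma norm_bas (i : Fin d) : ‖EuclideanSpace.basisFun (Fin d) ℝ i‖ = 1 :=
  OrthonormalBasis.norm_eq_one _ i

/-- If a kernel `k` acts on a smooth function `f` solving `(∂_t - aΔ) f ≈ ℓ` up to an error `F`,
then `(∂_t - aΔ)` of the mollification is the mollification of `ℓ` up to `‖k‖₁ F`. -/
lemma abs_heatD_mollify_sub_le {k : SpaceTime d → ℝ} (hk : IsKernel k) {lam : ℝ} (hl : 0 < lam)
    {f : SpaceTime d → ℝ} (hf : ContDiff ℝ ∞ f) (hfc : HasCompactSupport f) {a F N c₀ : ℝ}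
    {ν₀ p : EuclideanSpace ℝ (Fin d)} (hN : (∫ z, |k z|) ≤ N) {y : SpaceTime d}
    (hF : 0 ≤ F) (h : ∀ z ∈ pball y lam, |heatD a f z - aff c₀ ν₀ p z| ≤ F) :
    |heatD a (mollify k lam f) y - mollify k lam (aff c₀ ν₀ p) y| ≤ N * F := by
  rw [heatD_mollify hk hl hf hfc, ← mollify_sub hk hl
    (contDiff_heatD hf a).continuous.locallyIntegrable
    (contDiff_aff c₀ ν₀ p).continuous.locallyIntegrable]
  exact (abs_mollify_le hk hl h).trans (by gcongr)

/-- The affine right-hand side of a heat equation is controlled by the solution: test the equation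
with a kernel of unit parabolic scale. -/
lemma abs_aff_le {ρ : SpaceTime d → ℝ} (hρ : IsSymmKernel ρ) {N : ℝ} (hN1 : 1 ≤ N)
    (hN : (∫ z, |ρ z|) ≤ N) (hNt : (∫ z, |dirD tdir ρ z|) ≤ N)
    (hNe : ∀ e : EuclideanSpace ℝ (Fin d), ‖e‖ = 1 →
      (∫ z, |dirD (spc e) (dirD (spc e) ρ) z|) ≤ N)
    {Λ a : ℝ} (hΛ : 0 < Λ) (ha : a ∈ Set.Icc Λ Λ⁻¹)
    {f : SpaceTime d → ℝ} (hf : ContDiff ℝ ∞ f) (hfc : HasCompactSupport f)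
    {x : SpaceTime d} {R H F c₀ : ℝ} {ν₀ : EuclideanSpace ℝ (Fin d)} (hR : 0 < R) (hH : 0 ≤ H)
    (hF : 0 ≤ F) (hfH : ∀ y ∈ pball x R, |f y| ≤ H)
    (hLf : ∀ y ∈ pball x R, |heatD a f y - aff c₀ ν₀ x.2 y| ≤ F)
    {y : SpaceTime d} (hy : y ∈ pball x (3 * R / 4)) :
    |∫ z, ρ z| * |aff c₀ ν₀ x.2 y| ≤ 16 * N * (1 + Λ⁻¹ * d) * (H / R ^ 2) + N * F := by
  have hk := hρ.isKernel
  have hμ : 0 < R / 4 := by linarith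
  have hsub : pball y (R / 4) ⊆ pball x R :=
    pball_subset_pball (by rw [mem_pball] at hy; linarith)
  have ha0 : 0 < a := hΛ.trans_le ha.1
  have h1 := abs_heatD_mollify_sub_le hk hμ hf hfc hN (y := y) hF fun z hz => hLf z (hsub hz)
  rw [mollify_aff hρ hμ, Pi.smul_apply, smul_eq_mul] at h1
  have hfl : LocallyIntegrable f (volume : Measure (SpaceTime d)) :=
    hf.continuous.locallyIntegrable
  have ht : |dirD tdir (mollify ρ (R / 4) f) y| ≤ 16 * N * (H / R ^ 2) := by
    rw [dirD_tdir_mollify hk hμ hfl, Pi.smul_apply, smul_eq_mul, abs_mul,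
      abs_of_pos (by positivity)]
    calc ((R / 4) ^ 2)⁻¹ * |mollify (dirD tdir ρ) (R / 4) f y|
        ≤ ((R / 4) ^ 2)⁻¹ * (N * H) := by
          gcongr
          exact (abs_mollify_le (hk.dirD _) hμ fun z hz => hfH z (hsub hz)).trans (by gcongr)
      _ = _ := by field_simp; ring
  have hs : ∀ i : Fin d, |dirD (bas i) (dirD (bas i) (mollify ρ (R / 4) f)) y|
      ≤ 16 * N * (H / R ^ 2) := by
    intro i
    rw [bas, dirD_dirD_spc_mollify hk hμ hfl, Pi.smul_apply, smul_eq_mul, abs_mul,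
      abs_of_pos (by positivity)]
    calc ((R / 4) ^ 2)⁻¹ * |mollify _ (R / 4) f y|
        ≤ ((R / 4) ^ 2)⁻¹ * (N * H) := by
          gcongr
          exact (abs_mollify_le ((hk.dirD _).dirD _) hμ fun z hz => hfH z (hsub hz)).trans
            (mul_le_mul_of_nonneg_right (hNe _ (norm_bas i)) hH)
      _ = _ := by field_simp; ring
  have h2 : |heatD a (mollify ρ (R / 4) f) y| ≤ 16 * N * (1 + Λ⁻¹ * d) * (H / R ^ 2) := by
    unfold heatD
    have hsum : |∑ i, dirD (bas i) (dirD (bas i) (mollify ρ (R / 4) f)) y|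
        ≤ d * (16 * N * (H / R ^ 2)) := by
      refine (Finset.abs_sum_le_sum_abs _ _).trans ((Finset.sum_le_sum fun i _ => hs i).trans ?_)
      simp
    refine (abs_sub _ _).trans ?_
    rw [abs_mul, abs_of_pos ha0]
    calc _ ≤ 16 * N * (H / R ^ 2) + Λ⁻¹ * (d * (16 * N * (H / R ^ 2))) := by
          gcongr; exact ha.2
      _ = _ := by ring
  rw [← abs_mul]
  have h3 := abs_sub_abs_le_abs_sub ((∫ z, ρ z) * aff c₀ ν₀ x.2 y) (heatD a (mollify ρ (R / 4) f) y)
  rw [abs_sub_comm] at h1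
  linarith

/-- A bound on a spatially affine function on a parabolic ball bounds its slope. -/
lemma norm_slope_le {c₀ β R : ℝ} {ν₀ : EuclideanSpace ℝ (Fin d)} {x : SpaceTime d} (hR : 0 < R)
    (h : ∀ y ∈ pball x (3 * R / 4), |aff c₀ ν₀ x.2 y| ≤ β) : ‖ν₀‖ ≤ 4 * β / R := by
  have h0 := h x (by rw [mem_pball, pdist_self]; linarith)
  simp only [aff, sub_self, inner_zero_right, add_zero] at h0
  have hβ : 0 ≤ β := (abs_nonneg _).trans h0
  by_cases hν : ν₀ = 0
  · rw [hν, norm_zero]; positivity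
  have hn : 0 < ‖ν₀‖ := norm_pos_iff.2 hν
  have h1 := h (x.1, x.2 + (R / 2 / ‖ν₀‖) • ν₀) (by
    rw [mem_pball, pdist]
    simp only [sub_self, abs_zero, Real.sqrt_zero, zero_add, add_sub_cancel_left, norm_smul]
    rw [Real.norm_eq_abs, abs_of_pos (by positivity), div_mul_cancel₀ _ hn.ne']
    linarith)
  simp only [aff, add_sub_cancel_left, inner_smul_right, real_inner_self_eq_norm_sq] at h1
  have e : R / 2 / ‖ν₀‖ * ‖ν₀‖ ^ 2 = R / 2 * ‖ν₀‖ := by field_simp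
  rw [e] at h1
  rw [le_div_iff₀ hR]
  linarith [(abs_le.1 h0).1, (abs_le.1 h1).2]

/-- **Interior estimate.** If `f` solves a heat equation on `B_R(x)` up to an affine right-hand
side and an error `F`, then the mollification of `f` at scale `lam` has, on a smaller ball, second
spatial derivatives and time derivative of order `sup |f| / R²`, with a constant that does not
depend on `lam`; only the coefficient of the error `F` deteriorates as `lam → 0`. -/
lemma interior_estimate (Λ : ℝ) (hΛ : 0 < Λ) {ρ : SpaceTime d → ℝ} (hρ : IsSymmKernel ρ) :
    ∃ C : ℝ, 0 < C ∧ ∀ a ∈ Set.Icc Λ Λ⁻¹, ∀ f : SpaceTime d → ℝ, ContDiff ℝ ∞ f →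
      HasCompactSupport f → ∀ (x : SpaceTime d) (R lam H F c₀ : ℝ)
      (ν₀ : EuclideanSpace ℝ (Fin d)), 0 < lam → lam ≤ R / 4 → 0 ≤ H → 0 ≤ F →
      (∀ y ∈ pball x R, |f y| ≤ H) →
      (∀ y ∈ pball x R, |heatD a f y - aff c₀ ν₀ x.2 y| ≤ F) →
      ∀ y ∈ pball x (R / 32),
        (∀ e : EuclideanSpace ℝ (Fin d), ‖e‖ = 1 →
          |dirD (spc e) (dirD (spc e) (mollify ρ lam f)) y|
            ≤ C * ((H + (R / lam) ^ 2 * (R ^ 2 * F)) / R ^ 2)) ∧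
        |dirD tdir (mollify ρ lam f) y| ≤ C * ((H + (R / lam) ^ 2 * (R ^ 2 * F)) / R ^ 2) := by
  have hk := hρ.isKernel
  obtain ⟨N, hN1, hN, hNt, hNe⟩ := exists_kernel_bound hk
  set E : ℝ := 16 * N * (1 + Λ⁻¹ * d) + N with hE
  set K : ℝ := N + 4 * E with hK
  set b : ℝ := 2 + 6 * bernK d Λ with hb
  have hE0 : 0 ≤ E := by positivity
  have hK0 : 0 < K := by positivity
  have hb1 : 1 ≤ b := by
    have : 0 ≤ bernK d Λ := by unfold bernK; positivity
    linarith
  refine ⟨K + 32 * b ^ 2 * K + Λ⁻¹ * (d * (32 * b ^ 2 * K)), by positivity, ?_⟩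
  intro a ha f hf hfc x R lam H F c₀ ν₀ hl hlR hH hF hfH hLf
  have hR : 0 < R := by linarith
  have ha0 : 0 < a := hΛ.trans_le ha.1
  set S : ℝ := H + (R / lam) ^ 2 * (R ^ 2 * F) with hS
  set c : ℝ := ∫ z, ρ z with hc
  have hc0 : 0 < |c| := abs_pos.2 hρ.integral_ne_zero
  have hq1 : 1 ≤ R / lam := by rw [le_div_iff₀ hl]; linarith
  have hHS : H ≤ S := le_add_of_nonneg_right (by positivity)
  have hS0 : 0 ≤ S := hH.trans hHS
  have hF2 : F / lam ^ 2 ≤ S / R ^ 4 := by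
    have : F / lam ^ 2 = (R / lam) ^ 2 * (R ^ 2 * F) / R ^ 4 := by field_simp
    rw [this]; gcongr; rw [hS]; linarith
  have hF1 : F / lam ≤ S / R ^ 3 := by
    calc F / lam = F / lam * 1 := (mul_one _).symm
      _ ≤ F / lam * (R / lam) := by gcongr
      _ = F / lam ^ 2 * R := by field_simp
      _ ≤ S / R ^ 4 * R := by gcongr
      _ = _ := by field_simp
  have hF0 : F ≤ S / R ^ 2 := by
    calc F = F * 1 := (mul_one _).symm
      _ ≤ F * (R / lam) := by gcongr
      _ = F / lam * R := by field_simp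
      _ ≤ S / R ^ 3 * R := by gcongr
      _ = _ := by field_simp
  have hℓ : ∀ y ∈ pball x (3 * R / 4), |aff c₀ ν₀ x.2 y| ≤ E * (S / R ^ 2) / |c| := by
    intro y hy
    have h1 := abs_aff_le hρ hN1 hN hNt (fun e he => (hNe e he).2) hΛ ha hf hfc hR hH hF hfH hLf hy
    rw [le_div_iff₀ hc0, mul_comm]
    refine h1.trans ?_
    calc 16 * N * (1 + Λ⁻¹ * d) * (H / R ^ 2) + N * F
        ≤ 16 * N * (1 + Λ⁻¹ * d) * (S / R ^ 2) + N * (S / R ^ 2) := by gcongr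
      _ = _ := by rw [hE]; ring
  have hν := norm_slope_le hR hℓ
  set v := mollify ρ lam f with hv
  have hfl : LocallyIntegrable f (volume : Measure (SpaceTime d)) :=
    hf.continuous.locallyIntegrable
  have hvs : ContDiff ℝ ∞ v := contDiff_mollify hk hl hfl
  have hal : LocallyIntegrable (aff c₀ ν₀ x.2) (volume : Measure (SpaceTime d)) :=
    (contDiff_aff c₀ ν₀ x.2).continuous.locallyIntegrable
  have hsub : parEll x (R / 4) ⊆ pball x (3 * R / 4) :=
    parEll_subset_pball (by linarith) (by linarith)
  have hsub2 : ∀ y ∈ parEll x (R / 4), pball y lam ⊆ pball x R := fun y hy =>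
    pball_subset_pball (by have := mem_pball.1 (hsub hy); linarith)
  have hNS : N * (S / R ^ 2) ≤ K * (S / R ^ 2) := by gcongr; linarith
  -- the three bounds on `(∂_t - aΔ)` applied to `v` and its derivatives
  have L0 : ∀ y ∈ parEll x (R / 4), |heatD a v y| ≤ K * S / R ^ 2 := by
    intro y hy
    have h1 := abs_heatD_mollify_sub_le hk hl hf hfc hN hF fun z hz => hLf z (hsub2 y hy hz)
    rw [mollify_aff hρ hl, Pi.smul_apply, smul_eq_mul] at h1
    have h2 : |c * aff c₀ ν₀ x.2 y| ≤ E * (S / R ^ 2) := by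
      rw [abs_mul, mul_comm, ← le_div_iff₀ hc0]
      exact hℓ y (hsub hy)
    have h3 := abs_sub_abs_le_abs_sub (heatD a v y) (c * aff c₀ ν₀ x.2 y)
    have h4 : N * F ≤ N * (S / R ^ 2) := by gcongr
    have h5 : 0 ≤ E * (S / R ^ 2) := by positivity
    calc |heatD a v y| ≤ N * (S / R ^ 2) + E * (S / R ^ 2) := by linarith
      _ ≤ (N + 4 * E) * (S / R ^ 2) := by linarith
      _ = _ := by rw [hK]; ring
  have L1 : ∀ e : EuclideanSpace ℝ (Fin d), ‖e‖ = 1 → ∀ y ∈ parEll x (R / 4),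
      |heatD a (dirD (spc e) v) y| ≤ K * S / R ^ 3 := by
    intro e he y hy
    have h1 := abs_heatD_mollify_sub_le (hk.dirD (spc e)) hl hf hfc (hNe e he).1 hF
      fun z hz => hLf z (hsub2 y hy hz)
    have h2 : lam⁻¹ * mollify (dirD (spc e) ρ) lam (aff c₀ ν₀ x.2) y = c * inner ℝ ν₀ e := by
      have := congrFun (dirD_spc_mollify hk hl hal e) y
      rw [mollify_aff hρ hl, dirD_const_smul (contDiff_aff _ _ _), dirD_spc_aff] at this
      simpa using this.symm
    have h3 : heatD a (dirD (spc e) v) y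
        = lam⁻¹ * heatD a (mollify (dirD (spc e) ρ) lam f) y := by
      rw [hv, dirD_spc_mollify hk hl hfl, heatD_const_smul (contDiff_mollify (hk.dirD _) hl hfl)]
    have h4 : |heatD a (dirD (spc e) v) y - c * inner ℝ ν₀ e| ≤ N * (S / R ^ 3) := by
      rw [h3, ← h2, ← mul_sub, abs_mul, abs_of_pos (inv_pos.2 hl)]
      calc lam⁻¹ * _ ≤ lam⁻¹ * (N * F) := by gcongr
        _ = N * (F / lam) := by ring
        _ ≤ _ := by gcongr
    have h5 : |c * inner ℝ ν₀ e| ≤ 4 * E * (S / R ^ 3) := by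
      rw [abs_mul]
      calc |c| * |inner ℝ ν₀ e| ≤ |c| * (4 * (E * (S / R ^ 2) / |c|) / R) := by
            gcongr
            refine (abs_real_inner_le_norm _ _).trans ?_
            rw [he, mul_one]; exact hν
        _ = _ := by field_simp
    have h6 := abs_sub_abs_le_abs_sub (heatD a (dirD (spc e) v) y) (c * inner ℝ ν₀ e)
    calc |heatD a (dirD (spc e) v) y| ≤ N * (S / R ^ 3) + 4 * E * (S / R ^ 3) := by linarith
      _ = _ := by rw [hK]; ring
  have L2 : ∀ e : EuclideanSpace ℝ (Fin d), ‖e‖ = 1 → ∀ y ∈ parEll x (R / 4),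
      |heatD a (dirD (spc e) (dirD (spc e) v)) y| ≤ K * S / R ^ 4 := by
    intro e he y hy
    have h1 := abs_heatD_mollify_sub_le ((hk.dirD (spc e)).dirD (spc e)) hl hf hfc (hNe e he).2 hF
      fun z hz => hLf z (hsub2 y hy hz)
    have h2 : mollify (dirD (spc e) (dirD (spc e) ρ)) lam (aff c₀ ν₀ x.2) y = 0 := by
      have := congrFun (dirD_dirD_spc_mollify hk hl hal e) y
      rw [mollify_aff hρ hl, dirD_const_smul (contDiff_aff _ _ _), dirD_spc_aff,
        dirD_const_smul contDiff_const, dirD_const] at this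
      simpa [hl.ne'] using this.symm
    rw [h2, sub_zero] at h1
    rw [hv, dirD_dirD_spc_mollify hk hl hfl,
      heatD_const_smul (contDiff_mollify ((hk.dirD _).dirD _) hl hfl), abs_mul,
      abs_of_pos (by positivity)]
    calc (lam ^ 2)⁻¹ * _ ≤ (lam ^ 2)⁻¹ * (N * F) := by gcongr
      _ = N * (F / lam ^ 2) := by ring
      _ ≤ K * (S / R ^ 4) := by gcongr; linarith
      _ = _ := by ring
  have B0 : ∀ y ∈ parEll x (R / 4), |v y| ≤ K * S := by
    intro y hy
    calc |v y| ≤ (∫ z, |ρ z|) * H := abs_mollify_le hk hl fun z hz => hfH z (hsub2 y hy hz)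
      _ ≤ K * S := by gcongr; linarith
  have B1 : ∀ e : EuclideanSpace ℝ (Fin d), ‖e‖ = 1 → ∀ y ∈ parEll x (R / 4 / 2),
      |dirD (spc e) v y| ≤ 4 * b * K * S / R := by
    intro e he y hy
    have := bernstein hΛ ha hvs he (R := R / 4) (H := K * S) (by linarith) (by positivity) B0
      (fun z hz => (L0 z hz).trans (by gcongr; linarith))
      (fun z hz => (L1 e he z hz).trans (by gcongr; linarith)) hy
    refine this.trans (le_of_eq ?_)
    rw [← hb]; field_simp
  have hbK : K * S ≤ 4 * b * K * S := by
    have : 0 ≤ K * S := by positivity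
    nlinarith
  have B2 : ∀ e : EuclideanSpace ℝ (Fin d), ‖e‖ = 1 → ∀ y ∈ parEll x (R / 4 / 2 / 2),
      |dirD (spc e) (dirD (spc e) v) y| ≤ 32 * b ^ 2 * K * (S / R ^ 2) := by
    intro e he y hy
    have hm : parEll x (R / 4 / 2) ⊆ parEll x (R / 4) := parEll_half_subset (by linarith)
    have := bernstein hΛ ha (contDiff_dirD hvs (spc e)) he (R := R / 4 / 2)
      (H := 4 * b * K * S / R) (by linarith) (by positivity) (B1 e he)
      (fun z hz => (L1 e he z (hm hz)).trans (by
        calc K * S / R ^ 3 ≤ 4 * b * K * S / R ^ 3 := by gcongr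
          _ = 4 * b * K * S / R / R ^ 2 := by field_simp
          _ ≤ _ := by gcongr; linarith))
      (fun z hz => (L2 e he z (hm hz)).trans (by
        calc K * S / R ^ 4 ≤ 4 * b * K * S / R ^ 4 := by gcongr
          _ = 4 * b * K * S / R / R ^ 3 := by field_simp
          _ ≤ _ := by gcongr; linarith)) hy
    refine this.trans (le_of_eq ?_)
    rw [← hb]; field_simp; ring
  intro y hy
  have hyE : y ∈ parEll x (R / 4 / 2 / 2) := by
    refine pball_subset_parEll (by linarith) ?_
    rwa [show R / 4 / 2 / 2 / 2 = R / 32 by ring]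
  have hSR : 0 ≤ S / R ^ 2 := by positivity
  refine ⟨fun e he => (B2 e he y hyE).trans ?_, ?_⟩
  · gcongr
    have : 0 ≤ Λ⁻¹ * (d * (32 * b ^ 2 * K)) := by positivity
    linarith
  · have hy4 : y ∈ parEll x (R / 4) :=
      parEll_half_subset (by linarith) (parEll_half_subset (by linarith) hyE)
    have e1 : dirD tdir v y = heatD a v y + a * ∑ i, dirD (bas i) (dirD (bas i) v) y := by
      unfold heatD; ring
    have hsum : |∑ i, dirD (bas i) (dirD (bas i) v) y| ≤ d * (32 * b ^ 2 * K * (S / R ^ 2)) := by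
      refine (Finset.abs_sum_le_sum_abs _ _).trans
        ((Finset.sum_le_sum fun i _ => B2 _ (norm_bas i) y hyE).trans ?_)
      simp
    rw [e1]
    refine (abs_add_le _ _).trans ?_
    rw [abs_mul, abs_of_pos ha0]
    calc _ ≤ K * S / R ^ 2 + Λ⁻¹ * (d * (32 * b ^ 2 * K * (S / R ^ 2))) := by
          gcongr
          · exact L0 y hy4
          · exact ha.2
      _ = (K + Λ⁻¹ * (d * (32 * b ^ 2 * K))) * (S / R ^ 2) := by ring
      _ ≤ _ := by
          gcongr
          have : 0 ≤ 32 * b ^ 2 * K := by positivity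
          linarith

/-! ### Consequences of the hypotheses on the jet -/

lemma two_rpow_le_four {η : ℝ} (hη : η ≤ 2) : (2 : ℝ) ^ η ≤ 4 := by
  calc (2 : ℝ) ^ η ≤ 2 ^ (2 : ℝ) := Real.rpow_le_rpow_of_exponent_le (by norm_num) hη
    _ = 4 := by norm_num

lemma jetHolder_bound {η : ℝ} (hη : 0 < η) {U : SpaceTime d → SpaceTime d → ℝ}
    (hU : IsCenteredJet U) (hT : jetHolder η U < ⊤) {x y : SpaceTime d}
    (hx : x ∈ pball (0 : SpaceTime d) 1) (hy : y ∈ pball x (bdist x)) :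
    bdist x ^ η * |U x y| ≤ (jetHolder η U).toReal * pdist y x ^ η := by
  rcases eq_or_ne y x with rfl | hne
  · rw [hU.apply_self _ hx, pdist_self, Real.zero_rpow hη.ne']; simp
  have hp : 0 < pdist y x :=
    lt_of_le_of_ne (pdist_nonneg _ _) fun h => hne (eq_of_pdist_eq_zero h.symm)
  have h1 : ENNReal.ofReal (bdist x ^ η * (|U x y| / pdist y x ^ η)) ≤ jetHolder η U :=
    le_iSup₂_of_le x hx (le_iSup₂_of_le y ⟨hy, hne⟩ le_rfl)
  have h2 := (ENNReal.ofReal_le_iff_le_toReal hT.ne).1 h1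
  rwa [← mul_div_assoc, div_le_iff₀ (Real.rpow_pos_of_pos hp _)] at h2

lemma jetSup_bound {U : SpaceTime d → SpaceTime d → ℝ} (hS : jetSup U ≠ ⊤) {x y : SpaceTime d}
    (hx : x ∈ pball (0 : SpaceTime d) 1) (hy : y ∈ pball x (bdist x)) :
    |U x y| ≤ (jetSup U).toReal := by
  have h1 : ENNReal.ofReal |U x y| ≤ jetSup U :=
    le_iSup₂_of_le x hx (le_iSup₂_of_le (f := fun y _ => ENNReal.ofReal |U x y|) y hy le_rfl)
  exact (ENNReal.ofReal_le_iff_le_toReal hS).1 h1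

/-- The jet at a nearby base point `y`, measured with the weight of `x`. -/
lemma jetHolder_bound_shift {η : ℝ} (hη : 1 < η ∧ η < 2) {U : SpaceTime d → SpaceTime d → ℝ}
    (hU : IsCenteredJet U) (hT : jetHolder η U < ⊤) {x y z : SpaceTime d}
    (hx : x ∈ pball (0 : SpaceTime d) 1) (hy : y ∈ pball x (bdist x / 2))
    (hz : z ∈ pball y (bdist x / 2)) :
    bdist x ^ η * |U y z| ≤ 4 * (jetHolder η U).toReal * pdist z y ^ η := by
  have hD := bdist_pos hx
  have h1 : bdist x / 2 < bdist y := by have := bdist_le_of_mem hy; linarith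
  have hy1 : y ∈ pball (0 : SpaceTime d) 1 :=
    pball_bdist_subset x ((mem_pball.1 hy).trans (by linarith))
  have h2 := jetHolder_bound (by linarith) hU hT hy1 ((mem_pball.1 hz).trans h1)
  have h3 : bdist x ^ η ≤ 4 * bdist y ^ η := by
    calc bdist x ^ η ≤ (2 * bdist y) ^ η := by gcongr <;> linarith
      _ = 2 ^ η * bdist y ^ η := Real.mul_rpow (by norm_num) (by linarith)
      _ ≤ _ := by
        have := Real.rpow_nonneg (by linarith : 0 ≤ bdist y) η
        gcongr; exact two_rpow_le_four hη.2.le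
  calc bdist x ^ η * |U y z| ≤ 4 * bdist y ^ η * |U y z| := by gcongr
    _ = 4 * (bdist y ^ η * |U y z|) := by ring
    _ ≤ 4 * ((jetHolder η U).toReal * pdist z y ^ η) := by gcongr
    _ = _ := by ring

/-- The infimum in the splitting hypothesis is almost attained; the additional `1` in the constant
pays for this. -/
lemma exists_splitting {Λ η : ℝ} {A : Finset ℝ} (hA : ∀ κ ∈ A, 0 < κ ∧ κ ≤ η)
    {ρ : SpaceTime d → ℝ} {U : SpaceTime d → SpaceTime d → ℝ} {M : ℝ} (hM : 0 < M)
    (h : LocalSplitting Λ η A ρ U M) {x : SpaceTime d} (hx : x ∈ pball (0 : SpaceTime d) 1)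
    {lam R : ℝ} (hl : 0 < lam) (hlD : lam < bdist x / 10) (hRD : R < bdist x / 2)
    (hlR : lam ≤ R / 2) :
    ∃ a ∈ Set.Icc Λ Λ⁻¹, ∃ (c₀ : ℝ) (ν₀ : EuclideanSpace ℝ (Fin d)), ∀ y ∈ pball x R,
      |heatOp a (mollify ρ lam (U x)) y - aff c₀ ν₀ x.2 y|
        ≤ (A.card + 1) * M * (R ^ η / lam ^ 2) / bdist x ^ η := by
  have hR : 0 < R := by linarith
  have hD := Real.rpow_pos_of_pos (bdist_pos hx) η
  have h1 := h x hx lam R hl hlD hR hRD hlR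
  have hRη := Real.rpow_pos_of_pos hR η
  have hsum : ∑ κ ∈ A, R ^ (η - κ) * lam ^ (κ - 2) ≤ A.card * (R ^ η / lam ^ 2) := by
    rw [← nsmul_eq_mul]
    refine Finset.sum_le_card_nsmul _ _ _ fun κ hκ => ?_
    rw [Real.rpow_sub hR, Real.rpow_sub hl, Real.rpow_two]
    have h2 : lam ^ κ ≤ R ^ κ := Real.rpow_le_rpow hl.le (by linarith) (hA κ hκ).1.le
    have h3 := Real.rpow_pos_of_pos hR κ
    calc R ^ η / R ^ κ * (lam ^ κ / lam ^ 2) = R ^ η / lam ^ 2 * (lam ^ κ / R ^ κ) := by ring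
      _ ≤ R ^ η / lam ^ 2 * 1 := by gcongr; exact (div_le_one h3).2 h2
      _ = _ := mul_one _
  have hlt : (⨅ a₀ ∈ Set.Icc Λ Λ⁻¹, ⨅ (c₀ : ℝ) (ν₀ : EuclideanSpace ℝ (Fin d)),
        supNormOn (pball x R) fun y =>
          heatOp a₀ (mollify ρ lam (U x)) y - (c₀ + inner ℝ ν₀ (y.2 - x.2)))
      < ENNReal.ofReal ((A.card + 1) * M * (R ^ η / lam ^ 2) / bdist x ^ η) := by
    by_contra! hcon
    have h4 : ENNReal.ofReal ((A.card + 1) * M * (R ^ η / lam ^ 2))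
        ≤ ENNReal.ofReal (M * ∑ κ ∈ A, R ^ (η - κ) * lam ^ (κ - 2)) := by
      refine le_trans ?_ h1
      refine le_trans (le_of_eq ?_) (mul_le_mul_right hcon (ENNReal.ofReal (bdist x ^ η)))
      rw [← ENNReal.ofReal_mul hD.le, mul_div_cancel₀ _ hD.ne']
    rw [ENNReal.ofReal_le_ofReal_iff
      (mul_nonneg hM.le (Finset.sum_nonneg fun κ _ => by positivity))] at h4
    have h5 : M * ∑ κ ∈ A, R ^ (η - κ) * lam ^ (κ - 2) ≤ M * (A.card * (R ^ η / lam ^ 2)) := by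
      gcongr
    have h6 : 0 < M * (R ^ η / lam ^ 2) := by positivity
    linarith
  simp only [iInf_lt_iff] at hlt
  obtain ⟨a, ha, c₀, ν₀, hlt⟩ := hlt
  refine ⟨a, ha, c₀, ν₀, fun y hy => ?_⟩
  have h7 : ENNReal.ofReal |heatOp a (mollify ρ lam (U x)) y - aff c₀ ν₀ x.2 y|
      ≤ ENNReal.ofReal ((A.card + 1) * M * (R ^ η / lam ^ 2) / bdist x ^ η) :=
    (le_iSup₂_of_le (f := fun y _ => ENNReal.ofReal
      |heatOp a (mollify ρ lam (U x)) y - (c₀ + inner ℝ ν₀ (y.2 - x.2))|) y hy le_rfl).trans hlt.le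
  exact (ENNReal.ofReal_le_ofReal_iff (by positivity)).1 h7

/-- The function `U(x, ·)`, cut off outside a ball that stays away from the boundary of its
domain, so that it becomes an integrable function with compact support on all of space-time. -/
noncomputable def cutJet (U : SpaceTime d → SpaceTime d → ℝ) (x : SpaceTime d) :
    SpaceTime d → ℝ :=
  Set.indicator {z | pdist z x ≤ 9 / 10 * bdist x} (U x)

lemma cutJet_eq {U : SpaceTime d → SpaceTime d → ℝ} {x z : SpaceTime d}
    (h : pdist z x ≤ 9 / 10 * bdist x) : cutJet U x z = U x z :=
  Set.indicator_of_mem (s := {z | pdist z x ≤ 9 / 10 * bdist x}) h _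

lemma hasCompactSupport_cutJet (U : SpaceTime d → SpaceTime d → ℝ) (x : SpaceTime d) :
    HasCompactSupport (cutJet U x) :=
  HasCompactSupport.intro (isCompact_closed_pball x _) fun _ h => Set.indicator_of_notMem h _

lemma locallyIntegrable_cutJet {U : SpaceTime d → SpaceTime d → ℝ} (hU : IsCenteredJet U)
    {x : SpaceTime d} (hx : x ∈ pball (0 : SpaceTime d) 1) : LocallyIntegrable (cutJet U x) := by
  have hK := isCompact_closed_pball x (9 / 10 * bdist x)
  have hD := bdist_pos hx
  have hc : ContinuousOn (U x) {z | pdist z x ≤ 9 / 10 * bdist x} :=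
    (hU.smooth x hx).continuousOn.mono fun z (hz : pdist z x ≤ 9 / 10 * bdist x) =>
      pball_bdist_subset x (mem_pball.2 (by linarith))
  exact ((integrable_indicator_iff hK.isClosed.measurableSet).2
    (hc.integrableOn_compact hK)).locallyIntegrable

lemma mollify_cutJet {ρ : SpaceTime d → ℝ} (hρ : IsKernel ρ) (U : SpaceTime d → SpaceTime d → ℝ)
    {x y : SpaceTime d} {lam : ℝ} (hl : 0 < lam) (hlD : lam ≤ bdist x / 10)
    (hy : y ∈ pball x (bdist x / 2)) :
    mollify ρ lam (U x) y = mollify ρ lam (cutJet U x) y := by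
  unfold mollify
  congr 1; funext z
  by_cases hz : rescale ρ lam (y - z) = 0
  · simp [hz]
  · have h1 := pdist_lt_of_rescale_ne_zero hρ.tsupport_subset hl hz
    have h2 : pdist z y < lam := by rw [pdist_comm]; simpa [pdist] using h1
    have h3 := pdist_triangle z y x
    rw [mem_pball] at hy
    rw [cutJet_eq (by linarith)]

/-- Three-point continuity controls the effect of mollification on a jet: the linear term
`γ(x, y) · (z - y)` does not contribute, as the kernel is even in space. -/
lemma abs_mollify_cutJet_sub_le {η : ℝ} (hη : 1 < η ∧ η < 2) {A : Finset ℝ}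
    (hA : ∀ κ ∈ A, 0 < κ ∧ κ ≤ η) {ρ : SpaceTime d → ℝ} (hρ : IsSymmKernel ρ)
    {N : ℝ} (hN : (∫ z, |ρ z|) ≤ N)
    {U : SpaceTime d → SpaceTime d → ℝ} {γ : SpaceTime d → SpaceTime d → EuclideanSpace ℝ (Fin d)}
    {M : ℝ} (hM : 0 < M) (hU : IsCenteredJet U) (hT : jetHolder η U < ⊤)
    (h : ThreePointContinuity η A U γ M) {x y : SpaceTime d} (hx : x ∈ pball (0 : SpaceTime d) 1)
    {lam R : ℝ} (hl : 0 < lam) (hlR : lam ≤ R) (hlD : lam ≤ bdist x / 10)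
    (hRD : R ≤ bdist x / 2) (hy : y ∈ pball x R) :
    |mollify ρ lam (cutJet U x) y - (∫ z, ρ z) * cutJet U x y|
      ≤ N * ((4 * (jetHolder η U).toReal * lam ^ η + M * A.card * R ^ η) / bdist x ^ η) := by
  have hk := hρ.isKernel
  have hD := bdist_pos hx
  have hDη := Real.rpow_pos_of_pos hD η
  have hR : 0 < R := hl.trans_le hlR
  have hyD : y ∈ pball x (bdist x / 2) := (mem_pball.1 hy).trans_le hRD
  have hcy : cutJet U x y = U x y := cutJet_eq (by have := mem_pball.1 hyD; linarith)
  have h1 : mollify ρ lam (cutJet U x) y - (∫ z, ρ z) * cutJet U x y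
      = mollify ρ lam (fun z => cutJet U x z - aff (cutJet U x y) (γ x y) y.2 z) y := by
    rw [mollify_sub hk hl (locallyIntegrable_cutJet hU hx)
      (contDiff_aff _ _ _).continuous.locallyIntegrable, mollify_aff hρ hl]
    simp [aff]
  rw [h1]
  have hT0 : 0 ≤ (jetHolder η U).toReal := ENNReal.toReal_nonneg
  have hlη := Real.rpow_nonneg hl.le η
  have hRη := Real.rpow_nonneg hR.le η
  refine (abs_mollify_le hk hl (B := (4 * (jetHolder η U).toReal * lam ^ η
    + M * A.card * R ^ η) / bdist x ^ η) fun z hz => ?_).trans (by gcongr)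
  rw [mem_pball] at hz hy
  have hzD : z ∈ pball y (bdist x / 2) := hz.trans_le (by linarith)
  have hcz : cutJet U x z = U x z := cutJet_eq (by have := pdist_triangle z y x; linarith)
  rw [hcy, hcz, aff, le_div_iff₀ hDη, mul_comm]
  have h2 := h x hx y hyD z hzD
  have h3 := jetHolder_bound_shift hη hU hT hx hyD hzD
  have h4 : ∑ κ ∈ A, pdist y x ^ κ * pdist z y ^ (η - κ) ≤ A.card * R ^ η := by
    rw [← nsmul_eq_mul]
    refine Finset.sum_le_card_nsmul _ _ _ fun κ hκ => ?_
    obtain ⟨hκ0, hκη⟩ := hA κ hκ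
    calc pdist y x ^ κ * pdist z y ^ (η - κ) ≤ R ^ κ * R ^ (η - κ) := by
          gcongr
          · exact Real.rpow_nonneg (pdist_nonneg _ _) _
          · exact pdist_nonneg _ _
          · exact pdist_nonneg _ _
          · linarith
      _ = R ^ η := by rw [← Real.rpow_add hR]; congr 1; ring
  have h5 : pdist z y ^ η ≤ lam ^ η :=
    Real.rpow_le_rpow (pdist_nonneg _ _) hz.le (by linarith)
  have h6 : |U x z - (U x y + inner ℝ (γ x y) (z.2 - y.2))|
      ≤ |U x z - U x y - U y z - inner ℝ (γ x y) (z.2 - y.2)| + |U y z| := by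
    refine le_trans (le_of_eq ?_) (abs_add_le _ _)
    congr 1; ring
  calc bdist x ^ η * |U x z - (U x y + inner ℝ (γ x y) (z.2 - y.2))|
      ≤ bdist x ^ η * (|U x z - U x y - U y z - inner ℝ (γ x y) (z.2 - y.2)| + |U y z|) := by
        gcongr
    _ ≤ M * ∑ κ ∈ A, pdist y x ^ κ * pdist z y ^ (η - κ)
        + 4 * (jetHolder η U).toReal * pdist z y ^ η := by rw [mul_add]; linarith
    _ ≤ M * (A.card * R ^ η) + 4 * (jetHolder η U).toReal * lam ^ η := by gcongr
    _ = _ := by ring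

/-! ### Increments of smooth functions -/

lemma abs_second_difference_le {g g' g'' : ℝ → ℝ} {B : ℝ} (h1 : ∀ τ, HasDerivAt g (g' τ) τ)
    (h2 : ∀ τ, HasDerivAt g' (g'' τ) τ) (hB : ∀ τ ∈ Set.Icc (0 : ℝ) 2, |g'' τ| ≤ B) :
    |g 2 - 2 * g 1 + g 0| ≤ B := by
  have h3 : ∀ τ ∈ Set.Icc (0 : ℝ) 1, |g' (τ + 1) - g' τ| ≤ B := by
    intro τ hτ
    have := (convex_Icc (0 : ℝ) 2).norm_image_sub_le_of_norm_hasDerivWithin_le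
      (fun t _ => (h2 t).hasDerivWithinAt) hB
      (x := τ) (y := τ + 1) ⟨hτ.1, by linarith [hτ.2]⟩ ⟨by linarith [hτ.1], by linarith [hτ.2]⟩
    simpa using this
  have h4 : ∀ τ, HasDerivAt (fun τ => g (τ + 1) - g τ) (g' (τ + 1) - g' τ) τ := fun τ =>
    ((h1 (τ + 1)).comp_add_const τ 1).sub (h1 τ)
  have := (convex_Icc (0 : ℝ) 1).norm_image_sub_le_of_norm_hasDerivWithin_le
    (fun t _ => (h4 t).hasDerivWithinAt) h3 (x := 0) (y := 1) (by simp) (by simp)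
  simp only [Real.norm_eq_abs, sub_zero, abs_one, mul_one, zero_add] at this
  refine le_trans (le_of_eq ?_) this
  congr 1
  norm_num
  ring

lemma pdist_mk_le_of_abs_le {x : SpaceTime d} {s t : ℝ} {p : EuclideanSpace ℝ (Fin d)}
    (h : |s - x.1| ≤ |t - x.1|) : pdist (s, p) x ≤ pdist (t, p) x := by
  unfold pdist; gcongr

/-- Increment in time. -/
lemma abs_sub_time_le {v : SpaceTime d → ℝ} (hv : ContDiff ℝ ∞ v) {x z : SpaceTime d} {r W : ℝ}
    (hz : z ∈ pball x r) (hW : ∀ y ∈ pball x r, |dirD tdir v y| ≤ W) :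
    |v z - v (x.1, z.2)| ≤ r ^ 2 * W := by
  have hW0 : 0 ≤ W := (abs_nonneg _).trans (hW z hz)
  have hline : ∀ τ : ℝ, ((x.1, z.2) : SpaceTime d) + τ • tdir = (x.1 + τ, z.2) := fun τ => by
    simp [tdir]
  have := (convex_uIcc (0 : ℝ) (z.1 - x.1)).norm_image_sub_le_of_norm_hasDerivWithin_le
    (fun t _ => (hasDerivAt_line hv (x.1, z.2) tdir t).hasDerivWithinAt) (C := W) (fun τ hτ => by
      refine hW _ ?_
      rw [hline, mem_pball]
      refine lt_of_le_of_lt (pdist_mk_le_of_abs_le ?_) (mem_pball.1 hz)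
      have := Set.abs_sub_left_of_mem_uIcc hτ
      simpa using this) (Set.left_mem_uIcc) (Set.right_mem_uIcc)
  simp only [hline, add_sub_cancel, sub_zero, add_zero, Real.norm_eq_abs] at this
  have h1 : |z.1 - x.1| ≤ r ^ 2 := by
    refine (abs_fst_sub_le_pdist_sq z x).trans ?_
    have := pdist_nonneg z x
    rw [mem_pball] at hz
    gcongr
  calc |v z - v (x.1, z.2)| ≤ W * |z.1 - x.1| := this
    _ ≤ W * r ^ 2 := by gcongr
    _ = _ := mul_comm _ _

/-- Second increment in space. -/
lemma abs_second_diff_space_le {v : SpaceTime d → ℝ} (hv : ContDiff ℝ ∞ v) {x : SpaceTime d}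
    {r W : ℝ} (hr : 0 < r) (hW0 : 0 ≤ W) {h : EuclideanSpace ℝ (Fin d)} (hh : 2 * ‖h‖ < r)
    (hW : ∀ y ∈ pball x r, ∀ e : EuclideanSpace ℝ (Fin d), ‖e‖ = 1 →
      |dirD (spc e) (dirD (spc e) v) y| ≤ W) :
    |v (x.1, x.2 + (2 : ℝ) • h) - 2 * v (x.1, x.2 + h) + v x| ≤ r ^ 2 * W := by
  rcases eq_or_ne h 0 with rfl | hne
  · have h0 : v (x.1, x.2 + (2 : ℝ) • 0) - 2 * v (x.1, x.2 + 0) + v x = 0 := by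
      rw [smul_zero, add_zero, Prod.mk.eta]; ring
    rw [h0, abs_zero]
    positivity
  have hn : 0 < ‖h‖ := norm_pos_iff.2 hne
  set e : EuclideanSpace ℝ (Fin d) := ‖h‖⁻¹ • h with he
  have he1 : ‖e‖ = 1 := norm_smul_inv_norm hne
  have hspc : spc h = ‖h‖ • spc e := by
    rw [← spc_smul, he, smul_smul, mul_inv_cancel₀ hn.ne', one_smul]
  have hdd : dirD (spc h) (dirD (spc h) v) = ‖h‖ ^ 2 • dirD (spc e) (dirD (spc e) v) := by
    rw [hspc, dirD_smul, dirD_smul, dirD_const_smul (contDiff_dirD hv _), smul_smul, sq]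
  have hline : ∀ τ : ℝ, x + τ • spc h = (x.1, x.2 + τ • h) := fun τ => by
    simp [spc, Prod.ext_iff]
  have := abs_second_difference_le (fun τ => hasDerivAt_line hv x (spc h) τ)
    (fun τ => hasDerivAt_line (contDiff_dirD hv _) x (spc h) τ) (B := r ^ 2 * W) (fun τ hτ => by
      rw [hdd, Pi.smul_apply, smul_eq_mul, abs_mul, abs_of_nonneg (sq_nonneg _)]
      have hmem : x + τ • spc h ∈ pball x r := by
        rw [hline, mem_pball]
        have : pdist (x.1, x.2 + τ • h) x = ‖τ • h‖ := by simp [pdist]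
        rw [this, norm_smul, Real.norm_eq_abs, abs_of_nonneg hτ.1]
        nlinarith [hτ.2]
      have := hW _ hmem e he1
      gcongr
      linarith)
  have h1 := hline 1
  rw [one_smul, one_smul] at h1
  simpa only [hline, h1, one_smul, zero_smul, add_zero] using this

/-! ### The Schauder estimate for jets -/

lemma increment_arith {C₀ N n p P T M X e : ℝ} (hC₀ : 0 ≤ C₀) (hN : 0 ≤ N) (hn : 0 ≤ n)
    (hp : 0 ≤ p) (hp1 : p ≤ 1) (hP : 1 ≤ P) (hT : 0 ≤ T) (hM : 0 ≤ M) (hX : 0 ≤ X)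
    (he : e ≤ X * (32 * N ^ 2 * p * T + 8 * N ^ 2 * n * M)) :
    X * (4 * C₀ * N * p * T + p * (C₀ * (n + 1) * (P * M))) + e
      ≤ X * ((4 * C₀ * N + 32 * N ^ 2 + (C₀ + 8 * N ^ 2) * (n + 1)) * (p * T + P * M)) := by
  have hP0 : 0 ≤ P := by linarith
  have b1 : p * (C₀ * (n + 1) * (P * M)) ≤ 1 * (C₀ * (n + 1) * (P * M)) := by gcongr
  have b2 : 8 * N ^ 2 * n * M ≤ 8 * N ^ 2 * (n + 1) * (P * M) := by
    gcongr
    · linarith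
    · exact le_mul_of_one_le_left hM hP
  have b3 : 0 ≤ (C₀ + 8 * N ^ 2) * (n + 1) * (p * T) := by positivity
  have b4 : 0 ≤ (4 * C₀ * N + 32 * N ^ 2) * (P * M) := by positivity
  refine (add_le_add_right he _).trans ?_
  rw [← mul_add]
  gcongr
  linarith

/-- Twofold mollification multiplies by the square of the mass `c` of the kernel, up to twice the
error of a single mollification. -/
lemma abs_mollify_mollify_sub_le {ρ : SpaceTime d → ℝ} (hk : IsKernel ρ) {lam : ℝ} (hl : 0 < lam)
    {V : SpaceTime d → ℝ} (hV : LocallyIntegrable V) {N Er c : ℝ} (hN : (∫ z, |ρ z|) ≤ N)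
    (hcN : |c| ≤ N) (hEr : 0 ≤ Er) {y : SpaceTime d}
    (h : ∀ z ∈ pball y lam, |mollify ρ lam V z - c * V z| ≤ Er) :
    |mollify ρ lam (mollify ρ lam V) y - c ^ 2 * V y| ≤ 2 * (N * Er) := by
  have hfl : LocallyIntegrable (mollify ρ lam V) (volume : Measure (SpaceTime d)) :=
    (contDiff_mollify hk hl hV).continuous.locallyIntegrable
  have hcV : mollify ρ lam (fun z => c * V z) y = c * mollify ρ lam V y := by
    simp only [mollify, mul_assoc, integral_const_mul]
  have h1 : mollify ρ lam (mollify ρ lam V) y - c ^ 2 * V y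
      = mollify ρ lam (fun z => mollify ρ lam V z - c * V z) y
        + c * (mollify ρ lam V y - c * V y) := by
    rw [mollify_sub hk hl hfl (G := fun z => c * V z) (hV.smul c), hcV]
    ring
  have h2 : |mollify ρ lam (fun z => mollify ρ lam V z - c * V z) y| ≤ N * Er :=
    (abs_mollify_le hk hl h).trans (by gcongr)
  have h4 : |c * (mollify ρ lam V y - c * V y)| ≤ N * Er := by
    rw [abs_mul]
    exact mul_le_mul hcN (h y (by rw [mem_pball, pdist_self]; exact hl)) (abs_nonneg _)
      ((abs_nonneg c).trans hcN)
  rw [h1]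
  exact (abs_add_le _ _).trans (by linarith)

/-- Increments of a function `G` with `G x = 0`, some multiple of which is approximated by a
smooth function with controlled derivatives. -/
lemma increments_of_approx {v G : SpaceTime d → ℝ} (hv : ContDiff ℝ ∞ v) {x : SpaceTime d}
    (hG : G x = 0) {r m E W : ℝ} (hr : 0 < r) (hm : 0 < m) (hW : 0 ≤ W)
    (happ : ∀ y ∈ pball x r, |v y - m * G y| ≤ E)
    (ht : ∀ y ∈ pball x r, |dirD tdir v y| ≤ W)
    (hs : ∀ y ∈ pball x r, ∀ e : EuclideanSpace ℝ (Fin d), ‖e‖ = 1 →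
      |dirD (spc e) (dirD (spc e) v) y| ≤ W) :
    (∀ z ∈ pball x r, m * |G z - G (x.1, z.2)| ≤ r ^ 2 * W + 4 * E) ∧
      ∀ h : EuclideanSpace ℝ (Fin d), 2 * ‖h‖ < r →
        m * |G (x.1, x.2 + (2 : ℝ) • h) - 2 * G (x.1, x.2 + h)| ≤ r ^ 2 * W + 4 * E := by
  have h0 := happ x (by rw [mem_pball, pdist_self]; exact hr)
  have hE : 0 ≤ E := (abs_nonneg _).trans h0
  constructor
  · intro z hz
    have hz' : (x.1, z.2) ∈ pball x r := by
      refine lt_of_le_of_lt (pdist_mk_le_of_abs_le (t := z.1) ?_) (mem_pball.1 hz)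
      simp
    have h1 := abs_sub_time_le hv hz ht
    have h2 := happ z hz
    have h3 := happ _ hz'
    have e : |m * (G z - G (x.1, z.2))| ≤ r ^ 2 * W + 4 * E := by
      rw [abs_le] at *
      constructor <;> linarith [h1.1, h1.2, h2.1, h2.2, h3.1, h3.2]
    rwa [abs_mul, abs_of_pos hm] at e
  · intro h hh
    have hpd : ∀ p : EuclideanSpace ℝ (Fin d), pdist (x.1, x.2 + p) x = ‖p‖ := fun p => by
      simp [pdist]
    have hz1 : (x.1, x.2 + h) ∈ pball x r := by
      rw [mem_pball, hpd]; linarith [norm_nonneg h]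
    have hz2 : (x.1, x.2 + (2 : ℝ) • h) ∈ pball x r := by
      rw [mem_pball, hpd, norm_smul]; simpa using hh
    have h1 := happ _ hz1
    have h2 := happ _ hz2
    have h3 := abs_second_diff_space_le hv hr hW hh hs
    rw [hG, mul_zero, sub_zero] at h0
    have e : |m * (G (x.1, x.2 + (2 : ℝ) • h) - 2 * G (x.1, x.2 + h))| ≤ r ^ 2 * W + 4 * E := by
      rw [abs_le] at *
      constructor <;> linarith [h0.1, h0.2, h1.1, h1.2, h2.1, h2.2, h3.1, h3.2]
    rwa [abs_mul, abs_of_pos hm] at e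

lemma scaled_derivative_bound_eq {C₀ N n M T δ R X D : ℝ} (hδ : δ ≠ 0) (hR : R ≠ 0) :
    (δ * R) ^ 2 * (C₀ * ((N * (4 * T * X / D) + (R / (δ ^ 2 * R)) ^ 2
      * (R ^ 2 * ((n + 1) * M * (X / (δ ^ 2 * R) ^ 2) / D))) / R ^ 2))
      = X / D * (4 * C₀ * N * δ ^ 2 * T + δ ^ 2 * (C₀ * (n + 1) * ((δ ^ 8)⁻¹ * M))) := by
  have h1 : R / (δ ^ 2 * R) = (δ ^ 2)⁻¹ := by field_simp
  have h2 : X / (δ ^ 2 * R) ^ 2 = X * (δ ^ 4)⁻¹ * (R ^ 2)⁻¹ := by field_simp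
  have h3 : (δ ^ 8)⁻¹ = (δ ^ 2)⁻¹ ^ 2 * (δ ^ 4)⁻¹ := by field_simp
  have h4 : R ^ 2 * (R ^ 2)⁻¹ = 1 := mul_inv_cancel₀ (pow_ne_zero 2 hR)
  rw [h1, h2, h3, mul_pow]
  linear_combination (X / D * (4 * C₀ * N * δ ^ 2 * T)
    + δ ^ 2 * (C₀ * (n + 1) * ((δ ^ 2)⁻¹ ^ 2 * (δ ^ 4)⁻¹ * M)) * (X / D)
      * (R ^ 2 * (R ^ 2)⁻¹ + 1)) * h4

lemma mul_le_of_mul_le_div_mul {m q X D K Y : ℝ} (hm : 0 < m) (hD : 0 < D)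
    (h : m * q ≤ X / D * (K * Y)) : D * q ≤ K / m * X * Y := by
  have e : K / m * X * Y = D * (X / D * (K * Y) / m) := by field_simp
  rw [e]
  gcongr
  rwa [le_div_iff₀' hm]

/-- **Decay of increments.** Combining the interior estimate for the twofold mollification of
`U(x, ·)` at scale `δ² R` with the bound on the effect of mollification: on the ball of radius
`δ R`, time increments and second spatial increments of `U(x, ·)` are at most
`δ² [U]_η R^η`, up to multiples of `M`. -/
lemma increment_bound (Λ : ℝ) (hΛ : 0 < Λ) {η : ℝ} (hη : 1 < η ∧ η < 2) {A : Finset ℝ}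
    (hA : ∀ κ ∈ A, 0 < κ ∧ κ ≤ η) {ρ : SpaceTime d → ℝ} (hρ : IsSymmKernel ρ) :
    ∃ C : ℝ, 0 < C ∧ ∀ (U : SpaceTime d → SpaceTime d → ℝ)
      (γ : SpaceTime d → SpaceTime d → EuclideanSpace ℝ (Fin d)) (M : ℝ), 0 < M →
      IsCenteredJet U → jetHolder η U < ⊤ → LocalSplitting Λ η A ρ U M →
      ThreePointContinuity η A U γ M → ∀ x ∈ pball (0 : SpaceTime d) 1, ∀ δ R : ℝ,
      0 < δ → δ ≤ 1 / 32 → 0 < R → R < bdist x / 2 →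
      (∀ z ∈ pball x (δ * R), bdist x ^ η * |U x z - U x (x.1, z.2)|
        ≤ C * R ^ η * (δ ^ 2 * (jetHolder η U).toReal + (δ ^ 8)⁻¹ * M)) ∧
      (∀ h : EuclideanSpace ℝ (Fin d), 2 * ‖h‖ < δ * R →
        bdist x ^ η * |U x (x.1, x.2 + (2 : ℝ) • h) - 2 * U x (x.1, x.2 + h)|
        ≤ C * R ^ η * (δ ^ 2 * (jetHolder η U).toReal + (δ ^ 8)⁻¹ * M)) := by
  have hk := hρ.isKernel
  obtain ⟨C₀, hC₀, hint⟩ := interior_estimate Λ hΛ hρ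
  obtain ⟨N, hN1, hN, -⟩ := exists_kernel_bound hk
  set c : ℝ := ∫ z, ρ z with hc
  have hc0 : 0 < |c| := abs_pos.2 hρ.integral_ne_zero
  have hcN : |c| ≤ N := (norm_integral_le_integral_norm ρ).trans hN
  refine ⟨(4 * C₀ * N + 32 * N ^ 2 + (C₀ + 8 * N ^ 2) * (A.card + 1)) / c ^ 2,
    by have := sq_pos_of_pos hc0; rw [sq_abs] at this; positivity, ?_⟩
  intro U γ M hM hU hT hsplit hthree x hx δ R hδ hδ1 hR hRD
  set T : ℝ := (jetHolder η U).toReal with hTdef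
  have hT0 : 0 ≤ T := ENNReal.toReal_nonneg
  have hD := bdist_pos hx
  have hDη := Real.rpow_pos_of_pos hD η
  have hRη := Real.rpow_pos_of_pos hR η
  -- the mollification scale
  set lam : ℝ := δ ^ 2 * R with hlam
  have hl : 0 < lam := by positivity
  have hδ2 : δ ^ 2 ≤ 1 / 1024 := by
    calc δ ^ 2 ≤ (1 / 32) ^ 2 := by gcongr
      _ = 1 / 1024 := by norm_num
  have hlR : lam ≤ R / 1024 := by rw [hlam]; nlinarith
  have hlη : lam ^ η ≤ δ ^ 2 * R ^ η := by
    rw [hlam, Real.mul_rpow (by positivity) hR.le]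
    gcongr
    calc (δ ^ 2) ^ η ≤ (δ ^ 2) ^ (1 : ℝ) :=
          Real.rpow_le_rpow_of_exponent_ge (by positivity) (by linarith) hη.1.le
      _ = δ ^ 2 := Real.rpow_one _
  obtain ⟨a, ha, c₀, ν₀, hsp⟩ := exists_splitting hA hM hsplit hx hl (by linarith) hRD (by linarith)
  set V := cutJet U x with hV
  have hVl := locallyIntegrable_cutJet hU hx
  set f := mollify ρ lam V with hf
  have hfs : ContDiff ℝ ∞ f := contDiff_mollify hk hl hVl
  have hfc : HasCompactSupport f := hasCompactSupport_mollify hk hl (hasCompactSupport_cutJet U x)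
  have hfl : LocallyIntegrable f (volume : Measure (SpaceTime d)) :=
    hfs.continuous.locallyIntegrable
  set v := mollify ρ lam f with hv
  have hvs : ContDiff ℝ ∞ v := contDiff_mollify hk hl hfl
  have hVb : ∀ z ∈ pball x (2 * R), |V z| ≤ 4 * T * R ^ η / bdist x ^ η := by
    intro z hz
    have hz' : pdist z x < 2 * R := hz
    have h0 : |V z| ≤ |U x z| := by
      rw [hV, cutJet, ← Real.norm_eq_abs, ← Real.norm_eq_abs]
      exact norm_indicator_le_norm_self _ _
    refine h0.trans ?_
    rw [le_div_iff₀ hDη, mul_comm]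
    refine (jetHolder_bound (by linarith) hU hT hx (hz'.trans (by linarith))).trans ?_
    calc T * pdist z x ^ η ≤ T * (2 * R) ^ η := by
          gcongr
          · exact pdist_nonneg _ _
          · linarith
      _ = T * (2 ^ η * R ^ η) := by rw [Real.mul_rpow (by norm_num) hR.le]
      _ ≤ T * (4 * R ^ η) := by gcongr; exact two_rpow_le_four hη.2.le
      _ = _ := by ring
  have hfb : ∀ y ∈ pball x R, |f y| ≤ N * (4 * T * R ^ η / bdist x ^ η) := by
    intro y hy
    refine (abs_mollify_le hk hl fun z hz => hVb z (pball_subset_pball ?_ hz)).trans (by gcongr)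
    rw [mem_pball] at hy; linarith
  have hLf : ∀ y ∈ pball x R, |heatD a f y - aff c₀ ν₀ x.2 y|
      ≤ (A.card + 1) * M * (R ^ η / lam ^ 2) / bdist x ^ η := by
    intro y hy
    have hyD : y ∈ pball x (bdist x / 2) := (mem_pball.1 hy).trans hRD
    have h1 := hsp y hy
    rwa [heatOp_congr (isOpen_pball x (bdist x / 2))
      (fun z hz => mollify_cutJet hk U hl (by linarith) hz) a hyD, heatOp_eq_heatD hfs] at h1
  have hest := hint a ha f hfs hfc x R lam _ _ c₀ ν₀ hl (by linarith) (by positivity)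
    (by positivity) hfb hLf
  set W : ℝ := C₀ * ((N * (4 * T * R ^ η / bdist x ^ η)
    + (R / lam) ^ 2 * (R ^ 2 * ((A.card + 1) * M * (R ^ η / lam ^ 2) / bdist x ^ η))) / R ^ 2)
    with hW
  have hW0 : 0 ≤ W := by positivity
  have hWeq : (δ * R) ^ 2 * W = R ^ η / bdist x ^ η *
      (4 * C₀ * N * δ ^ 2 * T + δ ^ 2 * (C₀ * (A.card + 1) * ((δ ^ 8)⁻¹ * M))) := by
    rw [hW, hlam]; exact scaled_derivative_bound_eq hδ.ne' hR.ne'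
  set Er : ℝ := N * ((4 * T * lam ^ η + M * A.card * R ^ η) / bdist x ^ η) with hEr
  have hEr0 : 0 ≤ Er := by positivity
  have hmol : ∀ y ∈ pball x R, |f y - c * V y| ≤ Er := fun y hy =>
    abs_mollify_cutJet_sub_le hη hA hρ hN hM hU hT hthree hx hl (by linarith) (by linarith)
      hRD.le hy
  have hErle : 8 * (N * Er) ≤ R ^ η / bdist x ^ η *
      (32 * N ^ 2 * δ ^ 2 * T + 8 * N ^ 2 * A.card * M) := by
    calc 8 * (N * Er) = 8 * N ^ 2 * ((4 * T * lam ^ η + M * A.card * R ^ η) / bdist x ^ η) := by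
          rw [hEr]; ring
      _ ≤ 8 * N ^ 2 * ((4 * T * (δ ^ 2 * R ^ η) + M * A.card * R ^ η) / bdist x ^ η) := by gcongr
      _ = _ := by ring
  have hδ8 : 1 ≤ (δ ^ 8)⁻¹ :=
    (one_le_inv₀ (by positivity)).2 (pow_le_one₀ hδ.le (by linarith))
  have htot : (δ * R) ^ 2 * W + 8 * (N * Er) ≤ R ^ η / bdist x ^ η *
      ((4 * C₀ * N + 32 * N ^ 2 + (C₀ + 8 * N ^ 2) * (A.card + 1))
        * (δ ^ 2 * T + (δ ^ 8)⁻¹ * M)) := by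
    rw [hWeq]
    exact increment_arith hC₀.le (by linarith) (Nat.cast_nonneg _) (by positivity) (by linarith)
      hδ8 hT0 hM.le (by positivity) hErle
  have hδR : δ * R ≤ R / 32 := by nlinarith
  -- twofold mollification multiplies by `c²`, up to the error `2 N Er`
  have hvV : ∀ y ∈ pball x (δ * R), |v y - c ^ 2 * U x y| ≤ 2 * (N * Er) := by
    intro y hy
    rw [mem_pball] at hy
    have h3 : V y = U x y := cutJet_eq (by linarith)
    rw [← h3]
    exact abs_mollify_mollify_sub_le hk hl hVl hN hcN hEr0
      fun z hz => hmol z (pball_subset_pball (by linarith) hz)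
  have hsub : ∀ y ∈ pball x (δ * R), y ∈ pball x (R / 32) := fun y hy =>
    (mem_pball.1 hy).trans_le hδR
  have hc2 : 0 < c ^ 2 := by have := sq_pos_of_pos hc0; rwa [sq_abs] at this
  have hE8 : 4 * (2 * (N * Er)) = 8 * (N * Er) := by ring
  obtain ⟨i1, i2⟩ := increments_of_approx hvs (hU.apply_self x hx) (by positivity) hc2 hW0 hvV
    (fun y hy => (hest y (hsub y hy)).2) fun y hy => (hest y (hsub y hy)).1
  rw [hE8] at i1 i2
  exact ⟨fun z hz => mul_le_of_mul_le_div_mul hc2 hDη ((i1 z hz).trans htot),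
    fun h hh => mul_le_of_mul_le_div_mul hc2 hDη ((i2 h hh).trans htot)⟩

/-- The Hölder norm of the jet is absorbed: rescaling by a factor two in space contracts the
spatial part by `2^{1-η} < 1`, and everything else is small for small `δ`. -/
lemma jetHolder_le (Λ : ℝ) (hΛ : 0 < Λ) {η : ℝ} (hη : 1 < η ∧ η < 2) {A : Finset ℝ}
    (hA : ∀ κ ∈ A, 0 < κ ∧ κ ≤ η) {ρ : SpaceTime d → ℝ} (hρ : IsSymmKernel ρ) :
    ∃ C : ℝ, 0 < C ∧ ∀ (U : SpaceTime d → SpaceTime d → ℝ)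
      (γ : SpaceTime d → SpaceTime d → EuclideanSpace ℝ (Fin d)) (M : ℝ), 0 < M →
      IsCenteredJet U → jetHolder η U < ⊤ → jetSup U ≠ ⊤ → LocalSplitting Λ η A ρ U M →
      ThreePointContinuity η A U γ M →
      (jetHolder η U).toReal ≤ C * (M + (jetSup U).toReal) := by
  obtain ⟨C, hC, hinc⟩ := increment_bound Λ hΛ hη hA hρ
  have hη0 : 0 < η := by linarith
  set q : ℝ := 2 ^ (1 - η) with hq
  have hq1 : q < 1 := Real.rpow_lt_one_of_one_lt_of_neg (by norm_num) (by linarith)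
  have hq0 : 0 < q := by positivity
  -- `δ` is so small that the term `8 C δ^(2-η) [U]` takes half of the available room `1 - q`
  obtain ⟨δ, hδ, hδ1, hδs⟩ : ∃ δ : ℝ, 0 < δ ∧ δ ≤ 1 / 32 ∧ 8 * C * δ ^ (2 - η) ≤ (1 - q) / 2 := by
    set s : ℝ := (1 - q) / 2 / (8 * C) with hs
    have hs0 : 0 < s := div_pos (by linarith) (by positivity)
    refine ⟨min (1 / 32) (s ^ (1 / (2 - η))), by positivity, min_le_left _ _, ?_⟩
    have h2 : (0 : ℝ) < 2 - η := by linarith [hη.2]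
    have h1 : (min (1 / 32) (s ^ (1 / (2 - η)))) ^ (2 - η) ≤ s := by
      calc (min (1 / 32) (s ^ (1 / (2 - η)))) ^ (2 - η) ≤ (s ^ (1 / (2 - η))) ^ (2 - η) :=
            Real.rpow_le_rpow (by positivity) (min_le_right _ _) h2.le
        _ = s := by rw [← Real.rpow_mul hs0.le, one_div_mul_cancel h2.ne', Real.rpow_one]
    calc 8 * C * _ ≤ 8 * C * s := by gcongr
      _ = _ := by rw [hs]; field_simp
  set K : ℝ := 8 * C * (δ ^ 10)⁻¹ + 64 * (δ ^ 2)⁻¹ with hK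
  have hK0 : 0 < K := by positivity
  have hq2 : 0 < (1 - q) / 2 := by linarith
  refine ⟨K / ((1 - q) / 2), by positivity, ?_⟩
  intro U γ M hM hU hT hS hsplit hthree
  set T : ℝ := (jetHolder η U).toReal with hTdef
  set S : ℝ := (jetSup U).toReal with hSdef
  have hT0 : 0 ≤ T := ENNReal.toReal_nonneg
  have hS0 : 0 ≤ S := ENNReal.toReal_nonneg
  have hinc := hinc U γ M hM hU hT hsplit hthree
  have hKMS : 0 ≤ K * (M + S) := by positivity
  have hqT : 0 ≤ (1 + q) / 2 * T := by positivity
  have key : T ≤ (1 + q) / 2 * T + K * (M + S) := by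
    refine ENNReal.toReal_le_of_le_ofReal (by positivity) ?_
    refine iSup₂_le fun x hx => iSup₂_le fun z hz => ENNReal.ofReal_le_ofReal ?_
    obtain ⟨hzD, hzx⟩ := hz
    have hD := bdist_pos hx
    have hDη := Real.rpow_pos_of_pos hD η
    set r : ℝ := pdist z x with hr
    have hr0 : 0 < r :=
      lt_of_le_of_ne (pdist_nonneg _ _) fun h => hzx (eq_of_pdist_eq_zero h.symm)
    have hrη := Real.rpow_pos_of_pos hr0 η
    rw [← mul_div_assoc, div_le_iff₀ hrη]
    rcases lt_or_ge r (δ * bdist x / 8) with hnear | hfar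
    · set R : ℝ := 2 * r / δ with hR
      have hR0 : 0 < R := by positivity
      have hδR : δ * R = 2 * r := by rw [hR]; field_simp
      have hRD : R < bdist x / 2 := by
        rw [hR, div_lt_iff₀ hδ]; linarith [mul_pos hδ hD]
      obtain ⟨h1, h2⟩ := hinc x hx δ R hδ hδ1 hR0 hRD
      have hn : ‖z.2 - x.2‖ ≤ r := norm_snd_sub_le_pdist z x
      set h : EuclideanSpace ℝ (Fin d) := (2 : ℝ)⁻¹ • (z.2 - x.2) with hh
      have hhn : 2 * ‖h‖ = ‖z.2 - x.2‖ := by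
        rw [hh, norm_smul]; simp
      have h2h : x.2 + (2 : ℝ) • h = z.2 := by
        rw [hh, smul_smul]; simp
      have t1 := h1 z (by rw [mem_pball, hδR]; linarith)
      have t2 := h2 h (by rw [hhn, hδR]; linarith)
      rw [h2h] at t2
      have hpd : pdist (x.1, x.2 + h) x = ‖h‖ := by simp [pdist]
      have t3 := jetHolder_bound hη0 hU hT hx (y := (x.1, x.2 + h))
        (by rw [mem_pball, hpd]; rw [mem_pball] at hzD; linarith [norm_nonneg h])
      rw [hpd] at t3
      have t4 : 2 * (T * ‖h‖ ^ η) ≤ q * T * r ^ η := by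
        calc 2 * (T * ‖h‖ ^ η) ≤ 2 * (T * (r / 2) ^ η) := by gcongr; linarith
          _ = 2 / 2 ^ η * T * r ^ η := by rw [Real.div_rpow hr0.le (by norm_num)]; ring
          _ = q * T * r ^ η := by rw [hq, Real.rpow_sub (by norm_num), Real.rpow_one]
      have hRη : R ^ η ≤ 4 * (δ ^ η)⁻¹ * r ^ η := by
        rw [hR, Real.div_rpow (by positivity) hδ.le, Real.mul_rpow (by norm_num) hr0.le]
        have := Real.rpow_pos_of_pos hδ η
        calc 2 ^ η * r ^ η / δ ^ η ≤ 4 * r ^ η / δ ^ η := by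
              gcongr; exact two_rpow_le_four hη.2.le
          _ = _ := by ring
      have t5 : 2 * (C * R ^ η * (δ ^ 2 * T + (δ ^ 8)⁻¹ * M))
          ≤ ((1 - q) / 2 * T + 8 * C * (δ ^ 10)⁻¹ * M) * r ^ η := by
        have e1 : (δ ^ η)⁻¹ * δ ^ 2 = δ ^ (2 - η) := by
          rw [Real.rpow_sub hδ, Real.rpow_two]; ring
        have e2 : (δ ^ η)⁻¹ * (δ ^ 8)⁻¹ ≤ (δ ^ 10)⁻¹ := by
          rw [← mul_inv]
          refine inv_anti₀ (by positivity) ?_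
          have : δ ^ 2 ≤ δ ^ η := by
            rw [← Real.rpow_two]
            exact Real.rpow_le_rpow_of_exponent_ge hδ (by linarith) hη.2.le
          calc δ ^ 10 = δ ^ 2 * δ ^ 8 := by ring
            _ ≤ _ := by gcongr
        calc 2 * (C * R ^ η * (δ ^ 2 * T + (δ ^ 8)⁻¹ * M))
            ≤ 2 * (C * (4 * (δ ^ η)⁻¹ * r ^ η) * (δ ^ 2 * T + (δ ^ 8)⁻¹ * M)) := by gcongr
          _ = (8 * C * ((δ ^ η)⁻¹ * δ ^ 2) * T + 8 * C * ((δ ^ η)⁻¹ * (δ ^ 8)⁻¹) * M) * r ^ η := by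
              ring
          _ ≤ _ := by rw [e1]; gcongr
      have t6 : |U x z| ≤ |U x z - U x (x.1, z.2)|
          + |U x (x.1, z.2) - 2 * U x (x.1, x.2 + h)| + 2 * |U x (x.1, x.2 + h)| := by
        have e : U x z = (U x z - U x (x.1, z.2))
          + (U x (x.1, z.2) - 2 * U x (x.1, x.2 + h)) + 2 * U x (x.1, x.2 + h) := by ring
        have e2 : |2 * U x (x.1, x.2 + h)| = 2 * |U x (x.1, x.2 + h)| := by
          rw [abs_mul, abs_two]
        rw [← e2]
        conv_lhs => rw [e]
        exact abs_add_three _ _ _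
      have t7 : 8 * C * (δ ^ 10)⁻¹ * M ≤ K * (M + S) := by
        have : 0 ≤ 64 * (δ ^ 2)⁻¹ := by positivity
        have h8 : 0 ≤ 8 * C * (δ ^ 10)⁻¹ := by positivity
        calc 8 * C * (δ ^ 10)⁻¹ * M ≤ K * M := by gcongr; linarith
          _ ≤ K * (M + S) := by gcongr; linarith
      have t8 := mul_le_mul_of_nonneg_left t6 hDη.le
      calc bdist x ^ η * |U x z|
          ≤ 2 * (C * R ^ η * (δ ^ 2 * T + (δ ^ 8)⁻¹ * M)) + 2 * (T * ‖h‖ ^ η) := by linarith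
        _ ≤ ((1 - q) / 2 * T + 8 * C * (δ ^ 10)⁻¹ * M) * r ^ η + q * T * r ^ η := by linarith
        _ = ((1 + q) / 2 * T + 8 * C * (δ ^ 10)⁻¹ * M) * r ^ η := by ring
        _ ≤ _ := by gcongr
    · have h1 := jetSup_bound hS hx hzD
      have h2 : bdist x ^ η ≤ 64 * (δ ^ 2)⁻¹ * r ^ η := by
        calc bdist x ^ η ≤ (8 / δ * r) ^ η := by
              gcongr
              rw [div_mul_eq_mul_div, le_div_iff₀ hδ]; linarith
          _ = (8 / δ) ^ η * r ^ η := Real.mul_rpow (by positivity) hr0.le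
          _ ≤ (8 / δ) ^ (2 : ℝ) * r ^ η := by
              gcongr
              · rw [le_div_iff₀ hδ]; linarith
              · exact hη.2.le
          _ = _ := by rw [Real.rpow_two]; ring
      have h3 : 64 * (δ ^ 2)⁻¹ * S ≤ K * (M + S) := by
        have : 0 ≤ 8 * C * (δ ^ 10)⁻¹ := by positivity
        calc 64 * (δ ^ 2)⁻¹ * S ≤ K * S := by gcongr; linarith
          _ ≤ K * (M + S) := by gcongr; linarith
      calc bdist x ^ η * |U x z| ≤ 64 * (δ ^ 2)⁻¹ * r ^ η * S := by gcongr
        _ = 64 * (δ ^ 2)⁻¹ * S * r ^ η := by ring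
        _ ≤ _ := by gcongr; linarith
  rw [div_mul_eq_mul_div, le_div_iff₀ hq2]
  linarith

/-- The bound on `γ` is read off from three-point continuity, with third point
`y + r γ(x, y) / |γ(x, y)|` at distance `r = d(x, y)` from `y`. -/
lemma gubHolder_le {η : ℝ} (hη : 1 < η ∧ η < 2) {A : Finset ℝ}
    {U : SpaceTime d → SpaceTime d → ℝ} {γ : SpaceTime d → SpaceTime d → EuclideanSpace ℝ (Fin d)}
    {M : ℝ} (hM : 0 < M) (hU : IsCenteredJet U) (hT : jetHolder η U < ⊤)
    (hthree : ThreePointContinuity η A U γ M) :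
    gubHolder η γ ≤ ENNReal.ofReal (9 * (jetHolder η U).toReal + A.card * M) := by
  set T : ℝ := (jetHolder η U).toReal with hTdef
  have hT0 : 0 ≤ T := ENNReal.toReal_nonneg
  have hη0 : 0 < η := by linarith
  refine iSup₂_le fun x hx => iSup₂_le fun y hy => ENNReal.ofReal_le_ofReal ?_
  obtain ⟨hyD, hyx⟩ := hy
  have hD := bdist_pos hx
  have hDη := Real.rpow_pos_of_pos hD η
  set r : ℝ := pdist y x with hr
  have hyD' : r < bdist x / 2 := hyD
  have hr0 : 0 < r :=
    lt_of_le_of_ne (pdist_nonneg _ _) fun h => hyx (eq_of_pdist_eq_zero h.symm)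
  have hrη := Real.rpow_pos_of_pos hr0 η
  have hrη1 := Real.rpow_pos_of_pos hr0 (η - 1)
  rw [← mul_div_assoc, div_le_iff₀ hrη1]
  by_cases hγ : γ x y = 0
  · rw [hγ, norm_zero, mul_zero]; positivity
  have hn : 0 < ‖γ x y‖ := norm_pos_iff.2 hγ
  set z : SpaceTime d := (y.1, y.2 + (r / ‖γ x y‖) • γ x y) with hz
  have hzy : pdist z y = r := by
    have : pdist z y = ‖(r / ‖γ x y‖) • γ x y‖ := by simp [pdist, hz]
    rw [this, norm_smul, Real.norm_eq_abs, abs_of_pos (by positivity), div_mul_cancel₀ _ hn.ne']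
  have hzD : z ∈ pball y (bdist x / 2) := by rw [mem_pball, hzy]; exact hyD'
  have hzx : pdist z x ≤ 2 * r := by have := pdist_triangle z y x; linarith
  have h1 := hthree x hx y hyD z hzD
  have hin : inner ℝ (γ x y) (z.2 - y.2) = r * ‖γ x y‖ := by
    simp only [hz, add_sub_cancel_left, inner_smul_right, real_inner_self_eq_norm_sq]
    field_simp
  have hsum : ∑ κ ∈ A, pdist y x ^ κ * pdist z y ^ (η - κ) = A.card * r ^ η := by
    rw [← nsmul_eq_mul, ← Finset.sum_const]
    refine Finset.sum_congr rfl fun κ _ => ?_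
    rw [hzy, ← hr, ← Real.rpow_add hr0]; congr 1; ring
  rw [hin, hsum] at h1
  have h2 := jetHolder_bound hη0 hU hT hx (y := z) (by rw [mem_pball]; linarith)
  have h3 := jetHolder_bound hη0 hU hT hx (y := y) (by rw [mem_pball]; linarith)
  have h4 := jetHolder_bound_shift hη hU hT hx hyD hzD
  rw [← hTdef] at h2 h3 h4
  rw [hzy] at h4
  have h5 : pdist z x ^ η ≤ 4 * r ^ η := by
    calc pdist z x ^ η ≤ (2 * r) ^ η := Real.rpow_le_rpow (pdist_nonneg _ _) hzx hη0.le
      _ = 2 ^ η * r ^ η := Real.mul_rpow (by norm_num) hr0.le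
      _ ≤ _ := by gcongr; exact two_rpow_le_four hη.2.le
  have h6 : T * pdist z x ^ η ≤ T * (4 * r ^ η) := by gcongr
  have h7 : r * ‖γ x y‖ ≤ |U x z - U x y - U y z - r * ‖γ x y‖| + |U x z| + |U x y| + |U y z| := by
    have a1 := neg_abs_le (U x z - U x y - U y z - r * ‖γ x y‖)
    have a2 := le_abs_self (U x z)
    have a3 := neg_abs_le (U x y)
    have a4 := neg_abs_le (U y z)
    linarith
  have h8 := mul_le_mul_of_nonneg_left h7 hDη.le
  have h9 : r * (bdist x ^ η * ‖γ x y‖) ≤ r * ((9 * T + A.card * M) * r ^ (η - 1)) := by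
    have e : r * ((9 * T + A.card * M) * r ^ (η - 1)) = (9 * T + A.card * M) * r ^ η := by
      rw [Real.rpow_sub hr0, Real.rpow_one]; field_simp
    rw [e]
    linarith
  exact le_of_mul_le_mul_left h9 hr0

end Jets

theorem mainTheorem2 (d : ℕ) (hd : 1 ≤ d) (Λ : ℝ) (hΛ : 0 < Λ ∧ Λ < 1)
    (η : ℝ) (hη : 1 < η ∧ η < 2) (A : Finset ℝ) (hA : ∀ κ ∈ A, 0 < κ ∧ κ ≤ η)
    (ρ : SpaceTime d → ℝ) (hρ : Jets.IsSymmKernel ρ) :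
    ∃ C : ℝ≥0, ∀ (U : SpaceTime d → SpaceTime d → ℝ)
      (γ : SpaceTime d → SpaceTime d → EuclideanSpace ℝ (Fin d)) (M : ℝ), 0 < M →
      Jets.IsCenteredJet U →
      Jets.jetHolder η U < ⊤ →
      Jets.LocalSplitting Λ η A ρ U M →
      Jets.ThreePointContinuity η A U γ M →
      Jets.jetHolder η U + Jets.gubHolder η γ
        ≤ (C : ℝ≥0∞) * (ENNReal.ofReal M + Jets.jetSup U) := by
  obtain ⟨C, hC, hbound⟩ := Jets.jetHolder_le Λ hΛ.1 hη hA hρ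
  have hC' : 0 < 10 * C + A.card := by positivity
  refine ⟨(10 * C + A.card).toNNReal, fun U γ M hM hU hT hsplit hthree => ?_⟩
  change _ ≤ ENNReal.ofReal (10 * C + A.card) * _
  by_cases hS : Jets.jetSup U = ⊤
  · rw [hS, add_top, ENNReal.mul_top (by simpa using hC')]
    exact le_top
  have h1 := hbound U γ M hM hU hT hS hsplit hthree
  have h2 := Jets.gubHolder_le hη hM hU hT hthree
  have hT0 : 0 ≤ (Jets.jetHolder η U).toReal := ENNReal.toReal_nonneg
  have hS0 : 0 ≤ (Jets.jetSup U).toReal := ENNReal.toReal_nonneg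
  calc Jets.jetHolder η U + Jets.gubHolder η γ
      ≤ ENNReal.ofReal (Jets.jetHolder η U).toReal
        + ENNReal.ofReal (9 * (Jets.jetHolder η U).toReal + A.card * M) := by
        gcongr
        rw [ENNReal.ofReal_toReal hT.ne]
    _ = ENNReal.ofReal (10 * (Jets.jetHolder η U).toReal + A.card * M) := by
        rw [← ENNReal.ofReal_add hT0 (by positivity)]; congr 1; ring
    _ ≤ ENNReal.ofReal ((10 * C + A.card) * (M + (Jets.jetSup U).toReal)) := by
        refine ENNReal.ofReal_le_ofReal ?_
        have : 0 ≤ A.card * (Jets.jetSup U).toReal := by positivity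
        linarith
    _ = ENNReal.ofReal (10 * C + A.card) * (ENNReal.ofReal M + Jets.jetSup U) := by
        rw [ENNReal.ofReal_mul hC'.le, ENNReal.ofReal_add hM.le hS0, ENNReal.ofReal_toReal hS]
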